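/- **Tube formula for self-similar tilings.** Let $\Phi_j(x)=r_jM_jx+a_j$, $j=1,\dots,J$ ($J\ge 2$, $0<r_j<1$, $M_j\in O(d)$, $a_j\in\mathbb R^d$), be a self-similar system on $\mathbb R^d$. Let $F$ be its attractor (the unique nonempty compact set with $F=\Phi(F):=\bigcup_j\Phi_j(F)$) and let $C$ be the convex hull of $F$. Assume the tileset condition: $\operatorname{relint}C\not\subseteq\Phi(C)$ and $\operatorname{int}\Phi_j(C)\cap\operatorname{int}\Phi_\ell(C)=\emptyset$ for $j\ne\ell$. Assume that the tiling has a single generator $G$, i.e. $G$ is the only connected component of $\operatorname{relint}C\setminus\Phi(C)$. For a finite word $w=w_1\cdots w_k$ over $\{1,\dots,J\}$ (possibly empty) put $\Phi_w=\Phi_{w_k}\circ\cdots\circ\Phi_{w_1}$ and $r_w=r_{w_1}\cdots r_{w_k}$. Let $\mathcal T=\{\Phi_w(G)\}_w$ be the self-similar tiling. For bounded $A\subseteq\mathbb R^d$ let $V(A,\varepsilon)$ be the Lebesgue measure of $\{x\in A:\operatorname{dist}(x,\partial A)\le\varepsilon\}$, and let $V(\mathcal T,\varepsilon)$ be $V(A,\varepsilon)$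 for $A$ the union of the tiles. Let $g$ be the inradius of $G$ (the supremum of the radii of balls contained in $G$). Assume that $G$ is monophase: there are constants $\kappa_0,\dots,\kappa_{d-1}\in\mathbb R$ with $V(G,\varepsilon)=\sum_{k=0}^{d-1}\kappa_k\varepsilon^{d-k}$ for $0<\varepsilon<g$; put $\kappa_d=-\operatorname{vol}_d(G)$. Let $\zeta_{\mathfrak s}$ be the meromorphic extension to $\mathbb C$ of $\sum_w r_w^s$, let $\mathcal D_{\mathfrak s}$ be the set of its poles, and put $$\mathcal D_{\mathcal T}=\mathcal D_{\mathfrak s}\cup\{0,1,\dots,d-1\},\qquad \zeta_{\mathcal T}(\varepsilon,s)=\varepsilon^{d-s}\,\zeta_{\mathfrak s}(s)\sum_{k=0}^{d}\frac{g^{s-k}}{s-k}\,\kappa_k .$$ Then $$V(\mathcal T,\varepsilon)=\sum_{\omega\in\mathcal D_{\mathcal T}}\operatorname{res}\bigl(\zeta_{\mathcal T}(\varepsilon,s);\omega\bigr),$$ with no error term, as distributions on $(0,\,g/\min_j r_j)$. Precisely: for each $t\in\mathbb R$ there are only finitely many $\omega\in\mathcal D_{\mathcal T}$ with $|\operatorname{Im}\omega|\le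 t$, and there is a strictly increasing sequence $T_n\to\infty$ such that, for every $\varphi\in C_c^\infty(0,\infty)$ with support in $(0,\,g/\min_j r_j)$, $$\int_0^\infty V(\mathcal T,\varepsilon)\varphi(\varepsilon)\,d\varepsilon=\lim_{n\to\infty}\ \sum_{\omega\in\mathcal D_{\mathcal T},\ |\operatorname{Im}\omega|\le T_n}\operatorname{res}\Bigl(\int_0^\infty\zeta_{\mathcal T}(\varepsilon,s)\varphi(\varepsilon)\,d\varepsilon;\ s=\omega\Bigr).$$ -/

import Mathlib

open Set Filter Topology MeasureTheory
open scoped NNReal ENNReal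

/-! ## Inner neighbourhoods, inradius, residues -/

/-- The inner `ε`-neighbourhood `A_ε = {x ∈ A : dist (x, ∂A) ≤ ε}`. -/
def innerNeighbourhood {d : ℕ} (A : Set (EuclideanSpace ℝ (Fin d))) (ε : ℝ) :
    Set (EuclideanSpace ℝ (Fin d)) :=
  {x ∈ A | Metric.infDist x (frontier A) ≤ ε}

/-- The inner tube volume `V(A, ε)`: the `d`-dimensional Lebesgue measure of `A_ε`. -/
noncomputable def innerTubeVolume {d : ℕ} (A : Set (EuclideanSpace ℝ (Fin d))) (ε : ℝ) : ℝ :=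
  volume.real (innerNeighbourhood A ε)

/-- The inradius: the supremum of the radii of the balls contained in `A`. -/
noncomputable def inradius {d : ℕ} (A : Set (EuclideanSpace ℝ (Fin d))) : ℝ :=
  sSup {ε : ℝ | 0 < ε ∧ ∃ x, Metric.ball x ε ⊆ A}

/-- `G` is monophase with coefficients `κ 0, …, κ d`: below the inradius its inner tube volume is
the polynomial `∑_{k < d} κ k * ε ^ (d - k)` (no constant term), and `κ d = - vol G`.
The values `κ k` with `k > d` play no role. -/
def IsMonophase {d : ℕ} (G : Set (EuclideanSpace ℝ (Fin d))) (κ : ℕ → ℝ) : Prop :=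
  (∀ ε : ℝ, 0 < ε → ε < inradius G →
    innerTubeVolume G ε = ∑ k ∈ Finset.range d, κ k * ε ^ (d - k)) ∧
  κ d = - volume.real G

/-- The residue of `f` at `ω`: the value of `(2πi)⁻¹ ∮ f` over all sufficiently small circles
around `ω` (for `f` meromorphic at `ω` these integrals do not depend on the small radius). -/
noncomputable def residueAt (f : ℂ → ℂ) (ω : ℂ) : ℂ :=
  limUnder (𝓝[>] (0 : ℝ)) fun R => (2 * Real.pi * Complex.I)⁻¹ * ∮ z in C(ω, R), f z

/-! ## Self-similar systems -/

/-- A self-similar system: `J ≥ 2` contraction similitudes `x ↦ r_j M_j x + a_j` of `ℝ^d`, where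
`0 < r_j < 1` and `M_j` is a linear isometry. -/
structure SelfSimilarSystem (d J : ℕ) where
  two_le : 2 ≤ J
  ratio : Fin J → ℝ
  ratio_pos : ∀ j, 0 < ratio j
  ratio_lt_one : ∀ j, ratio j < 1
  rot : Fin J → (EuclideanSpace ℝ (Fin d) ≃ₗᵢ[ℝ] EuclideanSpace ℝ (Fin d))
  trans : Fin J → EuclideanSpace ℝ (Fin d)

namespace SelfSimilarSystem

/-- The `j`-th similitude. -/
noncomputable def map {d J : ℕ} (Φ : SelfSimilarSystem d J) (j : Fin J)
    (x : EuclideanSpace ℝ (Fin d)) : EuclideanSpace ℝ (Fin d) :=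
  Φ.ratio j • Φ.rot j x + Φ.trans j

/-- The action `Φ(A) = ⋃ j, Φ_j(A)` on sets. -/
def image {d J : ℕ} (Φ : SelfSimilarSystem d J) (A : Set (EuclideanSpace ℝ (Fin d))) :
    Set (EuclideanSpace ℝ (Fin d)) :=
  ⋃ j, Φ.map j '' A

/-- `Φ_w = Φ_{w_k} ∘ ⋯ ∘ Φ_{w_1}` for a finite word `w = w_1 ⋯ w_k` (the identity for the empty
word). -/
noncomputable def wordMap {d J : ℕ} (Φ : SelfSimilarSystem d J) (w : List (Fin J))
    (x : EuclideanSpace ℝ (Fin d)) : EuclideanSpace ℝ (Fin d) :=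
  w.foldl (fun y j => Φ.map j y) x

/-- The scaling ratio `r_w = r_{w_1} ⋯ r_{w_k}` of `Φ_w`. -/
def wordRatio {d J : ℕ} (Φ : SelfSimilarSystem d J) (w : List (Fin J)) : ℝ :=
  (w.map Φ.ratio).prod

/-- The attractor exists and is unique. -/
theorem existsUnique_attractor {d J : ℕ} (Φ : SelfSimilarSystem d J) :
    ∃! F : Set (EuclideanSpace ℝ (Fin d)), F.Nonempty ∧ IsCompact F ∧ Φ.image F = F := by
  have hJ : 0 < J := lt_of_lt_of_le two_pos Φ.two_le
  have : Nonempty (Fin J) := ⟨⟨0, hJ⟩⟩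
  obtain ⟨i, hi⟩ := Finite.exists_max Φ.ratio
  set q : ℝ≥0 := ⟨Φ.ratio i, (Φ.ratio_pos i).le⟩ with hq
  have hmap : ∀ j x y, edist (Φ.map j x) (Φ.map j y) ≤ q * edist x y := by
    intro j x y
    have h : LipschitzWith q (Φ.map j) := by
      refine LipschitzWith.of_dist_le_mul fun x y => ?_
      simp only [map, dist_add_right]
      rw [dist_smul₀, LinearIsometryEquiv.dist_map, Real.norm_eq_abs, abs_of_pos (Φ.ratio_pos j)]
      exact mul_le_mul_of_nonneg_right (hi j) dist_nonneg
    exact h x y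
  have hcont : ∀ j, Continuous (Φ.map j) := fun j => by
    unfold map; fun_prop
  let H : TopologicalSpace.NonemptyCompacts (EuclideanSpace ℝ (Fin d)) →
      TopologicalSpace.NonemptyCompacts (EuclideanSpace ℝ (Fin d)) := fun K =>
    ⟨⟨Φ.image K, isCompact_iUnion fun j => K.isCompact.image (hcont j)⟩,
      nonempty_iUnion.2 ⟨⟨0, hJ⟩, K.nonempty.image _⟩⟩
  have hlip : ContractingWith q H := by
    refine ⟨by rw [← NNReal.coe_lt_coe]; exact Φ.ratio_lt_one i, fun K L => ?_⟩
    change Metric.hausdorffEDist (Φ.image K) (Φ.image L) ≤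
      q * Metric.hausdorffEDist (K : Set (EuclideanSpace ℝ (Fin d))) L
    have key : ∀ (A B : Set (EuclideanSpace ℝ (Fin d))) (j : Fin J), ∀ x ∈ Φ.map j '' A,
        Metric.infEDist x (Φ.map j '' B) ≤ q * Metric.hausdorffEDist A B := by
      rintro A B j _ ⟨x, hx, rfl⟩
      have hle : ∀ y ∈ B, Metric.infEDist (Φ.map j x) (Φ.map j '' B) ≤ q * edist x y :=
        fun y hy => (Metric.infEDist_le_edist_of_mem (mem_image_of_mem _ hy)).trans (hmap j x y)
      have hq0 : (q : ℝ≥0∞) ≠ 0 := by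
        have : (0 : ℝ≥0) < q := by rw [← NNReal.coe_lt_coe]; exact Φ.ratio_pos i
        exact_mod_cast this.ne'
      calc Metric.infEDist (Φ.map j x) (Φ.map j '' B)
          ≤ q * Metric.infEDist x B := by
            rw [Metric.infEDist.eq_1 x B, ENNReal.mul_iInf_of_ne hq0 ENNReal.coe_ne_top]
            refine le_iInf fun y => ?_
            rw [ENNReal.mul_iInf_of_ne hq0 ENNReal.coe_ne_top]
            exact le_iInf fun hy => hle y hy
        _ ≤ q * Metric.hausdorffEDist A B := by
            gcongr
            exact Metric.infEDist_le_hausdorffEDist_of_mem hx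
    refine Metric.hausdorffEDist_iUnion_le.trans (iSup_le fun j => ?_)
    refine Metric.hausdorffEDist_le_of_infEDist (key _ _ j) fun x hx => ?_
    rw [Metric.hausdorffEDist_comm]
    exact key _ _ j x hx
  refine ⟨(hlip.fixedPoint H : TopologicalSpace.NonemptyCompacts _),
    ⟨(hlip.fixedPoint H).nonempty, (hlip.fixedPoint H).isCompact,
      congrArg (fun K : TopologicalSpace.NonemptyCompacts (EuclideanSpace ℝ (Fin d)) =>
        (K : Set (EuclideanSpace ℝ (Fin d)))) hlip.fixedPoint_isFixedPt⟩, ?_⟩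
  rintro F ⟨hne, hc, hF⟩
  have hfix : Function.IsFixedPt H ⟨⟨F, hc⟩, hne⟩ := by
    apply TopologicalSpace.NonemptyCompacts.ext
    exact hF
  exact congrArg (fun K : TopologicalSpace.NonemptyCompacts (EuclideanSpace ℝ (Fin d)) =>
    (K : Set (EuclideanSpace ℝ (Fin d)))) (hlip.fixedPoint_unique hfix)

/-- The attractor: the unique nonempty compact set `F` with `Φ(F) = F`. -/
noncomputable def attractor {d J : ℕ} (Φ : SelfSimilarSystem d J) :
    Set (EuclideanSpace ℝ (Fin d)) :=
  Φ.existsUnique_attractor.choose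

/-- The convex hull of the attractor. -/
noncomputable def hull {d J : ℕ} (Φ : SelfSimilarSystem d J) : Set (EuclideanSpace ℝ (Fin d)) :=
  convexHull ℝ Φ.attractor

/-- The relative interior of the hull. -/
noncomputable def hullInterior {d J : ℕ} (Φ : SelfSimilarSystem d J) :
    Set (EuclideanSpace ℝ (Fin d)) :=
  intrinsicInterior ℝ Φ.hull

/-- The tileset condition: the relative interior of the hull `C` is not covered by the first
iterate `Φ(C)`, and the sets `Φ_j(C)` have pairwise disjoint interiors. -/
def TilesetCondition {d J : ℕ} (Φ : SelfSimilarSystem d J) : Prop :=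
  ¬ Φ.hullInterior ⊆ Φ.image Φ.hull ∧
  ∀ j l : Fin J, j ≠ l →
    interior (Φ.map j '' Φ.hull) ∩ interior (Φ.map l '' Φ.hull) = ∅

/-- The generators: the connected components of `(relative interior of C) \ Φ(C)`. -/
def generators {d J : ℕ} (Φ : SelfSimilarSystem d J) : Set (Set (EuclideanSpace ℝ (Fin d))) :=
  {U | ∃ x ∈ Φ.hullInterior \ Φ.image Φ.hull,
    U = connectedComponentIn (Φ.hullInterior \ Φ.image Φ.hull) x}

/-- The self-similar tiling: all the images `Φ_w(U)`, for a finite word `w` (possibly empty) and a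
generator `U`. -/
def tiling {d J : ℕ} (Φ : SelfSimilarSystem d J) : Set (Set (EuclideanSpace ℝ (Fin d))) :=
  {R | ∃ w : List (Fin J), ∃ U ∈ Φ.generators, R = Φ.wordMap w '' U}

/-- The set that is tiled, i.e. the union of all (open) tiles. -/
def tilingSet {d J : ℕ} (Φ : SelfSimilarSystem d J) : Set (EuclideanSpace ℝ (Fin d)) :=
  ⋃₀ Φ.tiling

/-! ## Zeta functions and complex dimensions -/

/-- `ζ` is the meromorphic extension to `ℂ` of `∑_w r_w^s` (sum over all finite words), which is
the Mellin transform `∫ x^{-s} dη(x)` of the scaling measure `η = ∑_w δ_{1/r_w}`. Normal form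
(analytic away from the poles, value `0` at the poles) makes `ζ` unique as a function. -/
def IsScalingZeta {d J : ℕ} (Φ : SelfSimilarSystem d J) (ζ : ℂ → ℂ) : Prop :=
  MeromorphicNFOn ζ univ ∧
  ∃ σ : ℝ, ∀ s : ℂ, σ < s.re → HasSum (fun w : List (Fin J) => (Φ.wordRatio w : ℂ) ^ s) (ζ s)

/-- The meromorphic extension exists. -/
theorem exists_isScalingZeta {d J : ℕ} (Φ : SelfSimilarSystem d J) :
    ∃ ζ : ℂ → ℂ, Φ.IsScalingZeta ζ := by
  have hprod : ∀ (a : Fin J → ℂ), ∑ j, ‖a j‖ < 1 →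
      HasSum (fun w : List (Fin J) => (w.map a).prod) (1 - ∑ j, a j)⁻¹ := by
    intro a ha
    have hpow : ∀ {R : Type} [CommSemiring R] (b : Fin J → R) (n : ℕ),
        ∑ f : Fin n → Fin J, ((List.ofFn f).map b).prod = (∑ j, b j) ^ n := by
      intro R _ b n
      rw [Finset.sum_pow', Fintype.piFinset_univ]
      refine Finset.sum_congr rfl fun f _ => ?_
      rw [List.map_ofFn, List.prod_ofFn]
      rfl
    have hnorm : ∀ w : List (Fin J), ‖(w.map a).prod‖ = (w.map fun j => ‖a j‖).prod := by
      intro w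
      induction w with
      | nil => simp
      | cons j w ih => simp [ih]
    have hsum : Summable fun p : (n : ℕ) × (Fin n → Fin J) => ((List.ofFn p.2).map a).prod := by
      refine Summable.of_norm ?_
      rw [summable_sigma_of_nonneg fun _ => norm_nonneg _]
      refine ⟨fun n => (hasSum_fintype _).summable, ?_⟩
      simp only [tsum_fintype, hnorm, hpow]
      exact summable_geometric_of_lt_one (Finset.sum_nonneg fun _ _ => norm_nonneg _) ha
    have hlt : ‖∑ j, a j‖ < 1 := (norm_sum_le _ _).trans_lt ha
    have h2 := hsum.hasSum.sigma fun n => hasSum_fintype _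
    simp only [hpow] at h2
    have h3 : (∑' p : (n : ℕ) × (Fin n → Fin J), ((List.ofFn p.2).map a).prod)
        = (1 - ∑ j, a j)⁻¹ := h2.unique (hasSum_geometric_of_norm_lt_one hlt)
    have h4 := hsum.hasSum
    rw [h3] at h4
    exact (Equiv.hasSum_iff List.equivSigmaTuple.symm).1 h4
  have hcpow : ∀ (w : List (Fin J)) (s : ℂ),
      (Φ.wordRatio w : ℂ) ^ s = (w.map fun j => (Φ.ratio j : ℂ) ^ s).prod := by
    intro w s
    induction w with
    | nil => simp [wordRatio]
    | cons j w ih =>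
      have hw : 0 ≤ (w.map Φ.ratio).prod := by
        refine List.prod_nonneg fun x hx => ?_
        obtain ⟨i, -, rfl⟩ := List.mem_map.1 hx
        exact (Φ.ratio_pos i).le
      rw [List.map_cons, List.prod_cons, ← ih]
      simp only [wordRatio, List.map_cons, List.prod_cons, Complex.ofReal_mul]
      exact Complex.mul_cpow_ofReal_nonneg (Φ.ratio_pos j).le hw s
  refine ⟨(fun s => 1 - ∑ j, (Φ.ratio j : ℂ) ^ s)⁻¹, fun s _ => ?_, ?_⟩
  · refine MeromorphicNFAt.inv (AnalyticAt.meromorphicNFAt ?_)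
    have hd : Differentiable ℂ fun s : ℂ => 1 - ∑ j, (Φ.ratio j : ℂ) ^ s := by
      refine (differentiable_const _).sub (Differentiable.fun_sum fun j _ => ?_)
      refine differentiable_id.const_cpow (Or.inl ?_)
      exact_mod_cast (Φ.ratio_pos j).ne'
    exact hd.analyticAt s
  · have ht : Tendsto (fun x : ℝ => ∑ j, Φ.ratio j ^ x) atTop (𝓝 (∑ _j : Fin J, (0 : ℝ))) :=
      tendsto_finsetSum _ fun j _ => tendsto_rpow_atTop_of_base_lt_one _
        (by linarith [Φ.ratio_pos j]) (Φ.ratio_lt_one j)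
    rw [Finset.sum_const_zero] at ht
    obtain ⟨σ, hσ⟩ := eventually_atTop.1 (ht.eventually_lt_const one_pos)
    refine ⟨σ, fun s hs => ?_⟩
    have h := hprod (fun j => (Φ.ratio j : ℂ) ^ s) (by
      simp only [Complex.norm_cpow_eq_rpow_re_of_pos (Φ.ratio_pos _)]
      exact hσ _ hs.le)
    simp only [← hcpow] at h
    exact h

/-- The scaling zeta function. -/
noncomputable def scalingZeta {d J : ℕ} (Φ : SelfSimilarSystem d J) : ℂ → ℂ :=
  Φ.exists_isScalingZeta.choose

/-- The scaling complex dimensions: the poles of the scaling zeta function. -/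
def scalingDimensions {d J : ℕ} (Φ : SelfSimilarSystem d J) : Set ℂ :=
  {ω | meromorphicOrderAt Φ.scalingZeta ω < 0}

/-- The complex dimensions of the tiling: the scaling dimensions together with the integral
dimensions `0, 1, …, d - 1`. -/
def complexDimensions {d J : ℕ} (Φ : SelfSimilarSystem d J) : Set ℂ :=
  Φ.scalingDimensions ∪ {ω | ∃ k < d, ω = (k : ℂ)}

/-- The tubular zeta function
`ζ_T(ε, s) = ε^{d-s} ζ_s(s) ∑_{k=0}^{d} (g^{s-k} / (s-k)) κ_k`, where `g` is the inradius of the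
generator `G`. -/
noncomputable def tubularZeta {d J : ℕ} (Φ : SelfSimilarSystem d J)
    (G : Set (EuclideanSpace ℝ (Fin d))) (κ : ℕ → ℝ) (ε : ℝ) (s : ℂ) : ℂ :=
  (ε : ℂ) ^ ((d : ℂ) - s) * Φ.scalingZeta s *
    ∑ k ∈ Finset.range (d + 1),
      (inradius G : ℂ) ^ (s - (k : ℂ)) / (s - (k : ℂ)) * (κ k : ℂ)

/-- The action `⟨ζ_T(·, s), φ⟩ = ∫_0^∞ ζ_T(ε, s) φ(ε) dε` on a test function. -/
noncomputable def tubularZetaAction {d J : ℕ} (Φ : SelfSimilarSystem d J)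
    (G : Set (EuclideanSpace ℝ (Fin d))) (κ : ℕ → ℝ) (φ : ℝ → ℂ) (s : ℂ) : ℂ :=
  ∫ ε in Ioi (0 : ℝ), Φ.tubularZeta G κ ε s * φ ε

end SelfSimilarSystem

/-! The tiles `Φ_w(G)` are disjoint, open and similar to `G`, so `V(T, ε) = ∑_w r_w^d V(G, ε / r_w)`
(`hasSum_innerTubeVolume`). A Mellin transform turns this multiplicative convolution into a product:
at `s - d`, with `d - 1 < Re s < d` and `∑ r_j^{Re s} < 1`, the transform of `V(T, ·)` is `ζ_s(s)`
times that of `V(G, ·)` (`hasMellin_tilingSet`). The monophase polynomial on `(0, g)` gives the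
terms `k < d` of the polar sum, the constant value `vol G` beyond `g` gives the term `k = d`
(`hasMellin_monophase`). A line `Re s = c` of this kind exists because `∑ r_j^d < 1`, by comparing
volumes inside the hull (`sum_ratio_pow_lt_one`).

Parseval's formula then writes the pairing of `V(T, ·)` with `φ` as `(2πi)⁻¹` times the integral of
`⟨ζ_T(·, s), φ⟩` over `Re s = c`, and the contour is pushed to `Re s = -∞`. The scaling zeta
function is `1 / moran`, with `moran s = 1 - ∑ r_j^s`, so lower bounds for `moran` are needed. Far
to the left the smallest ratio `ρ` dominates and `|moran s| ≥ ρ^{Re s} / 2`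
(`exists_moran_lower_bound`); in the remaining strip there are horizontal lines in every window of
height one where `|moran|` exceeds a fixed constant (`exists_moran_line_bound`).

If `φ` is supported in `[a, b]`, its transform contributes `b^{-Re s} / (1 + (Im s)^2)`, and the
whole integrand is `O((g / (ρ b))^{Re s} / (1 + (Im s)^2))` on these contours. The left edge
therefore disappears when `b < g / ρ`, which is why there is no error term and why the formula is
asserted on `(0, g / ρ)`. The pole of the polar sum at `s = d` lies to the right of `c` and is never
met. -/

/-! ## The residue theorem for rectangles -/

section Residue

open Complex

/-- The integral of `f` over the boundary of `[x₀, x₁] × [y₀, y₁]`, counterclockwise. -/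
noncomputable def rectIntegral (f : ℂ → ℂ) (x₀ x₁ y₀ y₁ : ℝ) : ℂ :=
  (∫ x : ℝ in x₀..x₁, f (x + y₀ * I)) - (∫ x : ℝ in x₀..x₁, f (x + y₁ * I)) +
    I * (∫ y : ℝ in y₀..y₁, f (x₁ + y * I)) - I * (∫ y : ℝ in y₀..y₁, f (x₀ + y * I))

theorem integral_horizontal_eq_sub {Q q : ℂ → ℂ} {x₀ x₁ y : ℝ}
    (hQ : ∀ x ∈ uIcc x₀ x₁, HasDerivAt Q (q (x + y * I)) (x + y * I))
    (hq : ∀ x ∈ uIcc x₀ x₁, ContinuousAt q (x + y * I)) :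
    ∫ x : ℝ in x₀..x₁, q (x + y * I) = Q (x₁ + y * I) - Q (x₀ + y * I) := by
  have h := intervalIntegral.integral_eq_sub_of_hasDerivAt (a := x₀) (b := x₁)
    (f := fun x : ℝ => Q (x + y * I)) (f' := fun x : ℝ => q (x + y * I)) ?_ ?_
  · exact h
  · intro x hx
    have h1 : HasDerivAt (fun x : ℂ => x + y * I) 1 (x : ℂ) := (hasDerivAt_id _).add_const _
    have h2 := HasDerivAt.comp (x : ℂ) (hQ x hx) h1
    simpa using h2.comp_ofReal
  · refine ContinuousOn.intervalIntegrable fun x hx => ContinuousAt.continuousWithinAt ?_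
    exact ContinuousAt.comp (f := fun x : ℝ => (x : ℂ) + y * I) (hq x hx) (by fun_prop)

theorem integral_vertical_eq_sub {Q q : ℂ → ℂ} {x y₀ y₁ : ℝ}
    (hQ : ∀ y ∈ uIcc y₀ y₁, HasDerivAt Q (q (x + (y : ℝ) * I)) (x + (y : ℝ) * I))
    (hq : ∀ y ∈ uIcc y₀ y₁, ContinuousAt q (x + (y : ℝ) * I)) :
    I * ∫ y : ℝ in y₀..y₁, q (x + y * I) = Q (x + y₁ * I) - Q (x + y₀ * I) := by
  have h := intervalIntegral.integral_eq_sub_of_hasDerivAt (a := y₀) (b := y₁)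
    (f := fun y : ℝ => Q (x + y * I)) (f' := fun y : ℝ => I * q (x + y * I)) ?_ ?_
  · rw [← intervalIntegral.integral_const_mul]
    exact h
  · intro y hy
    have h1 : HasDerivAt (fun y : ℂ => (x : ℂ) + y * I) I (y : ℂ) := by
      simpa using ((hasDerivAt_id (y : ℂ)).mul_const I).const_add (x : ℂ)
    have h2 := HasDerivAt.comp (y : ℂ) (hQ y hy) h1
    rw [mul_comm]
    exact h2.comp_ofReal
  · refine ContinuousOn.intervalIntegrable fun y hy => ContinuousAt.continuousWithinAt ?_
    exact continuousAt_const.mul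
      (ContinuousAt.comp (f := fun y : ℝ => (x : ℂ) + y * I) (hq y hy) (by fun_prop))

/-- The primitive is single-valued on the punctured plane, so its increments along the four edges
telescope. -/
theorem rectIntegral_eq_zero_of_hasDerivAt {Q q : ℂ → ℂ} {ω : ℂ} {x₀ x₁ y₀ y₁ : ℝ}
    (hx : ω.re ∈ Ioo x₀ x₁) (hy : ω.im ∈ Ioo y₀ y₁)
    (hQ : ∀ z, z ≠ ω → HasDerivAt Q (q z) z) (hq : ∀ z, z ≠ ω → ContinuousAt q z) :
    rectIntegral q x₀ x₁ y₀ y₁ = 0 := by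
  have hh : ∀ x y : ℝ, y ≠ ω.im → (x + y * I : ℂ) ≠ ω := fun x y h he => h (by simp [← he])
  have hv : ∀ x y : ℝ, x ≠ ω.re → (x + y * I : ℂ) ≠ ω := fun x y h he => h (by simp [← he])
  unfold rectIntegral
  rw [integral_horizontal_eq_sub (fun x _ => hQ _ (hh x _ hy.1.ne))
      fun x _ => hq _ (hh x _ hy.1.ne),
    integral_horizontal_eq_sub (fun x _ => hQ _ (hh x _ hy.2.ne'))
      fun x _ => hq _ (hh x _ hy.2.ne'),
    integral_vertical_eq_sub (fun y _ => hQ _ (hv _ y hx.2.ne')) fun y _ => hq _ (hv _ y hx.2.ne'),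
    integral_vertical_eq_sub (fun y _ => hQ _ (hv _ y hx.1.ne)) fun y _ => hq _ (hv _ y hx.1.ne)]
  ring

/-- No branch of the logarithm covers the whole boundary. `log (z - ω)` serves the bottom, right and
top edges; the left edge crosses its cut, so `log (ω - z)` is used there. The two branches differ by
`πi` at the upper left corner and by `-πi` at the lower one, which leaves `2πi`. -/
theorem rectIntegral_sub_inv {ω : ℂ} {x₀ x₁ y₀ y₁ : ℝ}
    (hx : ω.re ∈ Ioo x₀ x₁) (hy : ω.im ∈ Ioo y₀ y₁) :
    rectIntegral (fun z => (z - ω)⁻¹) x₀ x₁ y₀ y₁ = 2 * Real.pi * I := by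
  have hc : ∀ z : ℂ, z ≠ ω → ContinuousAt (fun z => (z - ω)⁻¹) z := fun z hz =>
    (continuousAt_id.sub continuousAt_const).inv₀ (sub_ne_zero.2 hz)
  have hd1 : ∀ z : ℂ, z - ω ∈ slitPlane →
      HasDerivAt (fun z => log (z - ω)) ((z - ω)⁻¹) z := fun z hz => by
    simpa using ((hasDerivAt_id z).sub_const ω).clog hz
  have hd2 : ∀ z : ℂ, ω - z ∈ slitPlane →
      HasDerivAt (fun z => log (ω - z)) ((z - ω)⁻¹) z := fun z hz => by
    have := ((hasDerivAt_id z).const_sub ω).clog hz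
    rwa [neg_div, ← div_neg, id, neg_sub, one_div] at this
  have hh : ∀ x y : ℝ, y ≠ ω.im → (x + y * I : ℂ) ≠ ω := fun x y h he => h (by simp [← he])
  have hv : ∀ x y : ℝ, x ≠ ω.re → (x + y * I : ℂ) ≠ ω := fun x y h he => h (by simp [← he])
  have hs : ∀ x y : ℝ, y ≠ ω.im → (x + y * I : ℂ) - ω ∈ slitPlane := fun x y h =>
    Or.inr (by simpa [sub_eq_zero] using h)
  unfold rectIntegral
  rw [integral_horizontal_eq_sub (fun x _ => hd1 _ (hs x _ hy.1.ne))
      fun x _ => hc _ (hh x _ hy.1.ne),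
    integral_horizontal_eq_sub (fun x _ => hd1 _ (hs x _ hy.2.ne'))
      fun x _ => hc _ (hh x _ hy.2.ne'),
    integral_vertical_eq_sub (fun y _ => hd1 _ (Or.inl (by simpa using hx.2)))
      fun y _ => hc _ (hv _ y hx.2.ne'),
    integral_vertical_eq_sub (fun y _ => hd2 _ (Or.inl (by simpa using hx.1)))
      fun y _ => hc _ (hv _ y hx.1.ne)]
  have e1 : log ((x₀ + y₁ * I : ℂ) - ω) - log (ω - (x₀ + y₁ * I)) = Real.pi * I := by
    rw [← neg_sub ω, log, log, norm_neg,
      arg_neg_eq_arg_add_pi_of_im_neg (by simpa using hy.2)]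
    push_cast; ring
  have e0 : log ((x₀ + y₀ * I : ℂ) - ω) - log (ω - (x₀ + y₀ * I)) = -(Real.pi * I) := by
    rw [← neg_sub ω, log, log, norm_neg,
      arg_neg_eq_arg_sub_pi_of_im_pos (by simpa using hy.1)]
    push_cast; ring
  linear_combination e1 - e0

/-- The principal part of a meromorphic function, split into its residue term and a function that
has a primitive. -/
theorem MeromorphicAt.exists_principal_part {F : ℂ → ℂ} {ω : ℂ} (hF : MeromorphicAt F ω) :
    ∃ (a : ℂ) (Q q h : ℂ → ℂ), AnalyticAt ℂ h ω ∧ (∀ z, z ≠ ω → HasDerivAt Q (q z) z) ∧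
      (∀ z, z ≠ ω → DifferentiableAt ℂ q z) ∧
      ∀ᶠ z in 𝓝[≠] ω, F z = h z + (a * (z - ω)⁻¹ + q z) := by
  obtain ⟨n, hn⟩ := hF
  -- Induction on the pole order, splitting `u` into `u ω` and `(z - ω)` times `dslope u ω`. The
  -- constant leaves `u ω * (z - ω)^{-(n+1)}`, which has a primitive unless `n = 0`; that
  -- exceptional case feeds the residue `a`.
  have key : ∀ (n : ℕ) (u : ℂ → ℂ), AnalyticAt ℂ u ω →
      ∃ (a : ℂ) (Q q h : ℂ → ℂ), AnalyticAt ℂ h ω ∧ (∀ z, z ≠ ω → HasDerivAt Q (q z) z) ∧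
      (∀ z, z ≠ ω → DifferentiableAt ℂ q z) ∧
      ∀ z, z ≠ ω → u z * ((z - ω) ^ n)⁻¹ = h z + (a * (z - ω)⁻¹ + q z) := by
    intro n
    induction n with
    | zero =>
      intro u hu
      exact ⟨0, 0, 0, u, hu, fun z _ => hasDerivAt_const _ _, fun z _ => differentiableAt_const _,
        fun z _ => by simp⟩
    | succ n ih =>
      intro u hu
      have hu1 : AnalyticAt ℂ (dslope u ω) ω := by
        obtain ⟨p, hp⟩ := hu
        exact ⟨_, hp.has_fpower_series_dslope_fslope⟩
      have hsplit : ∀ z, z ≠ ω → u z * ((z - ω) ^ (n + 1))⁻¹ =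
          dslope u ω z * ((z - ω) ^ n)⁻¹ + u ω * ((z - ω) ^ (n + 1))⁻¹ := by
        intro z hz
        have h0 := sub_ne_zero.2 hz
        rw [dslope_of_ne _ hz, slope_def_field]
        field_simp
        ring
      obtain ⟨a, Q, q, h, hh, hQ, hq, he⟩ := ih _ hu1
      rcases Nat.eq_zero_or_pos n with rfl | hn0
      · refine ⟨a + u ω, Q, q, h, hh, hQ, hq, fun z hz => ?_⟩
        rw [hsplit z hz, he z hz]
        ring
      · have hn1 : (n : ℂ) ≠ 0 := by exact_mod_cast hn0.ne'
        refine ⟨a, fun z => Q z + u ω * (-(n : ℂ)⁻¹ * ((z - ω) ^ n)⁻¹),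
          fun z => q z + u ω * ((z - ω) ^ (n + 1))⁻¹, h, hh, fun z hz => ?_, fun z hz => ?_,
          fun z hz => ?_⟩
        · have h0 := sub_ne_zero.2 hz
          have h1 : HasDerivAt (fun z : ℂ => (z - ω) ^ n) (n * (z - ω) ^ (n - 1) * 1) z :=
            ((hasDerivAt_id z).sub_const ω).pow n
          have h2 := (h1.fun_inv (pow_ne_zero _ h0)).const_mul (-(n : ℂ)⁻¹)
          refine (hQ z hz).add ((h2.congr_deriv ?_).const_mul _)
          obtain ⟨m, rfl⟩ : ∃ m, n = m + 1 := ⟨n - 1, by omega⟩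
          rw [Nat.add_sub_cancel]
          field_simp
          ring
        · refine (hq z hz).add (DifferentiableAt.const_mul ?_ _)
          exact ((differentiableAt_id.sub_const ω).pow _).inv (pow_ne_zero _ (sub_ne_zero.2 hz))
        · rw [hsplit z hz, he z hz]
          ring
  obtain ⟨a, Q, q, h, hh, hQ, hq, he⟩ := key n _ hn
  refine ⟨a, Q, q, h, hh, hQ, hq, ?_⟩
  filter_upwards [self_mem_nhdsWithin] with z hz
  rw [← he z hz, smul_eq_mul, mul_comm, ← mul_assoc, inv_mul_cancel₀, one_mul]
  exact pow_ne_zero _ (sub_ne_zero.2 hz)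

theorem eventually_forall_sphere {p : ℂ → Prop} {ω : ℂ} (hp : ∀ᶠ z in 𝓝[≠] ω, p z) :
    ∀ᶠ R in 𝓝[>] (0 : ℝ), ∀ z ∈ Metric.sphere ω R, p z := by
  rw [eventually_nhdsWithin_iff, Metric.eventually_nhds_iff] at hp
  obtain ⟨ε, hε, h⟩ := hp
  filter_upwards [Ioo_mem_nhdsGT hε] with R hR z hz
  rw [Metric.mem_sphere] at hz
  refine h (by rw [hz]; exact hR.2) fun he => ?_
  rw [mem_singleton_iff.1 he, dist_self] at hz
  exact hR.1.ne hz

theorem residueAt_eq_of_eventually {F : ℂ → ℂ} {ω a : ℂ}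
    (h : ∀ᶠ R in 𝓝[>] (0 : ℝ), (∮ z in C(ω, R), F z) = 2 * Real.pi * I * a) :
    residueAt F ω = a := by
  refine Tendsto.limUnder_eq (tendsto_const_nhds.congr' ?_)
  filter_upwards [h] with R hR
  rw [hR, inv_mul_cancel_left₀ two_pi_I_ne_zero]

theorem AnalyticAt.eventually_circleIntegral_eq_zero {h : ℂ → ℂ} {ω : ℂ} (hh : AnalyticAt ℂ h ω) :
    ∀ᶠ R in 𝓝[>] (0 : ℝ), CircleIntegrable h ω R ∧ (∮ z in C(ω, R), h z) = 0 := by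
  obtain ⟨ε, hε, hb⟩ := Metric.eventually_nhds_iff_ball.1 hh.eventually_analyticAt
  filter_upwards [Ioo_mem_nhdsGT hε] with R hR
  have hd : DifferentiableOn ℂ h (Metric.closedBall ω R) := fun z hz =>
    (hb z (Metric.closedBall_subset_ball hR.2 hz)).differentiableAt.differentiableWithinAt
  exact ⟨(hd.continuousOn.mono Metric.sphere_subset_closedBall).circleIntegrable hR.1.le,
    (hd.mono (Metric.closure_ball_subset_closedBall)).diffContOnCl.circleIntegral_eq_zero hR.1.le⟩

theorem residueAt_congr {F G : ℂ → ℂ} {ω : ℂ} (h : F =ᶠ[𝓝[≠] ω] G) :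
    residueAt F ω = residueAt G ω := by
  unfold residueAt limUnder
  congr 1
  refine Filter.map_congr ?_
  filter_upwards [eventually_forall_sphere h, self_mem_nhdsWithin] with R hR h0
  rw [circleIntegral.integral_congr (le_of_lt h0) hR]

theorem MeromorphicAt.eventually_circleIntegrable {F : ℂ → ℂ} {ω : ℂ} (hF : MeromorphicAt F ω) :
    ∀ᶠ R in 𝓝[>] (0 : ℝ), CircleIntegrable F ω R := by
  filter_upwards [eventually_forall_sphere hF.eventually_continuousAt, self_mem_nhdsWithin]
    with R hR h0
  exact ContinuousOn.circleIntegrable (le_of_lt h0) fun z hz => (hR z hz).continuousWithinAt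

theorem residueAt_add_analytic {F P : ℂ → ℂ} {ω : ℂ} (hF : MeromorphicAt F ω)
    (hP : AnalyticAt ℂ P ω) : residueAt (fun z => F z + P z) ω = residueAt F ω := by
  unfold residueAt limUnder
  congr 1
  refine Filter.map_congr ?_
  filter_upwards [hF.eventually_circleIntegrable, hP.eventually_circleIntegral_eq_zero]
    with R hR hR'
  rw [circleIntegral.integral_add hR hR'.1, hR'.2, add_zero]

theorem residueAt_eq_of_principal_part {F Q q h : ℂ → ℂ} {ω a : ℂ} (hh : AnalyticAt ℂ h ω)
    (hQ : ∀ z, z ≠ ω → HasDerivAt Q (q z) z) (hq : ∀ z, z ≠ ω → DifferentiableAt ℂ q z)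
    (he : ∀ᶠ z in 𝓝[≠] ω, F z = h z + (a * (z - ω)⁻¹ + q z)) : residueAt F ω = a := by
  refine residueAt_eq_of_eventually ?_
  filter_upwards [eventually_forall_sphere he, self_mem_nhdsWithin,
    hh.eventually_circleIntegral_eq_zero] with R hR h0 hh0
  have hne : ∀ z ∈ Metric.sphere ω R, z ≠ ω := fun z hz => Metric.ne_of_mem_sphere hz h0.ne'
  have i1 : CircleIntegrable (fun z => a * (z - ω)⁻¹) ω R :=
    ContinuousOn.circleIntegrable (le_of_lt h0) fun z hz =>
      (continuousAt_const.mul ((continuousAt_id.sub continuousAt_const).inv₀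
        (sub_ne_zero.2 (hne z hz)))).continuousWithinAt
  have i2 : CircleIntegrable q ω R := ContinuousOn.circleIntegrable (le_of_lt h0) fun z hz =>
    (hq z (hne z hz)).continuousAt.continuousWithinAt
  have i3 : CircleIntegrable (fun z => a * (z - ω)⁻¹ + q z) ω R := i1.add i2
  rw [circleIntegral.integral_congr (le_of_lt h0) hR,
    circleIntegral.integral_add hh0.1 i3, circleIntegral.integral_add i1 i2, hh0.2,
    circleIntegral.integral_const_mul, circleIntegral.integral_sub_center_inv _ h0.ne',
    circleIntegral.integral_eq_zero_of_hasDerivWithinAt (le_of_lt h0)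
      fun z hz => (hQ z (hne z hz)).hasDerivWithinAt]
  ring

theorem rectIntegral_add {F G : ℂ → ℂ} {x₀ x₁ y₀ y₁ : ℝ}
    (hF : ∀ x ∈ uIcc x₀ x₁, ∀ y ∈ uIcc y₀ y₁, (x = x₀ ∨ x = x₁ ∨ y = y₀ ∨ y = y₁) →
      ContinuousAt F ((x : ℝ) + (y : ℝ) * I))
    (hG : ∀ x ∈ uIcc x₀ x₁, ∀ y ∈ uIcc y₀ y₁, (x = x₀ ∨ x = x₁ ∨ y = y₀ ∨ y = y₁) →
      ContinuousAt G ((x : ℝ) + (y : ℝ) * I)) :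
    rectIntegral (fun z => F z + G z) x₀ x₁ y₀ y₁ =
      rectIntegral F x₀ x₁ y₀ y₁ + rectIntegral G x₀ x₁ y₀ y₁ := by
  have key : ∀ F : ℂ → ℂ, (∀ x ∈ uIcc x₀ x₁, ∀ y ∈ uIcc y₀ y₁,
      (x = x₀ ∨ x = x₁ ∨ y = y₀ ∨ y = y₁) → ContinuousAt F ((x : ℝ) + (y : ℝ) * I)) →
      (∀ y ∈ uIcc y₀ y₁, (y = y₀ ∨ y = y₁) →
        IntervalIntegrable (fun x : ℝ => F (x + y * I)) volume x₀ x₁) ∧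
      (∀ x ∈ uIcc x₀ x₁, (x = x₀ ∨ x = x₁) →
        IntervalIntegrable (fun y : ℝ => F (x + y * I)) volume y₀ y₁) := by
    intro F hF
    refine ⟨fun y hy h => ContinuousOn.intervalIntegrable fun x hx =>
      ContinuousAt.continuousWithinAt ?_, fun x hx h => ContinuousOn.intervalIntegrable fun y hy =>
      ContinuousAt.continuousWithinAt ?_⟩
    · exact ContinuousAt.comp (f := fun x : ℝ => (x : ℂ) + y * I) (hF x hx y hy (by tauto))
        (by fun_prop)
    · exact ContinuousAt.comp (f := fun y : ℝ => (x : ℂ) + y * I) (hF x hx y hy (by tauto))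
        (by fun_prop)
  obtain ⟨f1, f2⟩ := key F hF
  obtain ⟨g1, g2⟩ := key G hG
  unfold rectIntegral
  rw [intervalIntegral.integral_add (f1 y₀ left_mem_uIcc (by tauto))
      (g1 y₀ left_mem_uIcc (by tauto)),
    intervalIntegral.integral_add (f1 y₁ right_mem_uIcc (by tauto))
      (g1 y₁ right_mem_uIcc (by tauto)),
    intervalIntegral.integral_add (f2 x₀ left_mem_uIcc (by tauto)) (g2 x₀ left_mem_uIcc (by tauto)),
    intervalIntegral.integral_add (f2 x₁ right_mem_uIcc (by tauto))
      (g2 x₁ right_mem_uIcc (by tauto))]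
  ring

theorem rectIntegral_congr {F G : ℂ → ℂ} {x₀ x₁ y₀ y₁ : ℝ}
    (h : ∀ x ∈ uIcc x₀ x₁, ∀ y ∈ uIcc y₀ y₁, (x = x₀ ∨ x = x₁ ∨ y = y₀ ∨ y = y₁) →
      F ((x : ℝ) + (y : ℝ) * I) = G (x + y * I)) :
    rectIntegral F x₀ x₁ y₀ y₁ = rectIntegral G x₀ x₁ y₀ y₁ := by
  unfold rectIntegral
  rw [intervalIntegral.integral_congr fun x hx => h x hx y₀ left_mem_uIcc (by tauto),
    intervalIntegral.integral_congr fun x hx => h x hx y₁ right_mem_uIcc (by tauto),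
    intervalIntegral.integral_congr fun y hy => h x₀ left_mem_uIcc y hy (by tauto),
    intervalIntegral.integral_congr fun y hy => h x₁ right_mem_uIcc y hy (by tauto)]

/-- **Residue theorem** for rectangles. -/
theorem rectIntegral_eq_sum_residueAt {x₀ x₁ y₀ y₁ : ℝ} (hx : x₀ ≤ x₁) (hy : y₀ ≤ y₁)
    (S : Finset ℂ) (hS : ∀ ω ∈ S, ω.re ∈ Ioo x₀ x₁ ∧ ω.im ∈ Ioo y₀ y₁) (F : ℂ → ℂ)
    (hF : ∀ ω ∈ S, MeromorphicAt F ω)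
    (hd : ∀ z : ℂ, z.re ∈ Icc x₀ x₁ → z.im ∈ Icc y₀ y₁ → z ∉ S → DifferentiableAt ℂ F z) :
    rectIntegral F x₀ x₁ y₀ y₁ = 2 * Real.pi * I * ∑ ω ∈ S, residueAt F ω := by
  induction S using Finset.induction_on generalizing F with
  | empty =>
    have h := Complex.integral_boundary_rect_eq_zero_of_differentiableOn F (x₀ + y₀ * I)
      (x₁ + y₁ * I) (fun z hz => by
        rw [mem_reProdIm] at hz
        simp only [add_re, ofReal_re, mul_re, I_re, mul_zero, ofReal_im, I_im, mul_one, sub_self,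
          add_zero, add_im, mul_im, zero_add, uIcc_of_le hx, uIcc_of_le hy] at hz
        exact (hd z hz.1 hz.2 (by simp)).differentiableWithinAt)
    simpa [rectIntegral] using h
  | insert ω S hω ih =>
    obtain ⟨a, Q, q, h, hh, hQ, hq, he⟩ := (hF ω (by simp)).exists_principal_part
    set P : ℂ → ℂ := fun z => a * (z - ω)⁻¹ + q z with hP
    have hPd : ∀ z, z ≠ ω → DifferentiableAt ℂ P z := fun z hz =>
      (((differentiableAt_id.sub_const ω).inv (sub_ne_zero.2 hz)).const_mul a).add (hq z hz)
    -- The singularity at `ω` is removed by subtracting the principal part and filling in the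
    -- analytic value. Since `P` is analytic away from `ω`, the residues at the other points do not
    -- change.
    set G : ℂ → ℂ := Function.update (fun z => F z - P z) ω (h ω) with hG
    have hGne : ∀ z, z ≠ ω → G z = F z - P z := fun z hz => Function.update_of_ne hz _ _
    have hGev : ∀ z, z ≠ ω → G =ᶠ[𝓝 z] fun z => F z - P z := fun z hz => by
      filter_upwards [isOpen_ne.mem_nhds hz] with y hy' using hGne y hy'
    have hGh : G =ᶠ[𝓝 ω] h := by
      rw [eventually_nhdsWithin_iff] at he
      filter_upwards [he] with z hz
      rcases eq_or_ne z ω with rfl | hne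
      · exact Function.update_self _ _ _
      · rw [hGne z hne, hz hne]; ring
    have hPan : ∀ z, z ≠ ω → AnalyticAt ℂ P z := fun z hz => by
      refine DifferentiableOn.analyticAt (s := {ω}ᶜ) (fun y hy' => ?_)
        (isOpen_compl_singleton.mem_nhds hz)
      exact (hPd y hy').differentiableWithinAt
    have hSne : ∀ z ∈ S, z ≠ ω := fun z hz h0 => hω (h0 ▸ hz)
    have ih' := ih (fun z hz => hS z (Finset.mem_insert_of_mem hz)) G
      (fun z hz => ((hF z (Finset.mem_insert_of_mem hz)).sub
        (hPan z (hSne z hz)).meromorphicAt).congr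
          (((hGev z (hSne z hz)).filter_mono nhdsWithin_le_nhds).symm))
      (fun z h1 h2 h3 => by
        rcases eq_or_ne z ω with rfl | hne
        · exact (hh.congr hGh.symm).differentiableAt
        · exact ((hd z h1 h2 (by simp [hne, h3])).sub (hPd z hne)).congr_of_eventuallyEq
            (hGev z hne))
    have hωr := hS ω (by simp)
    have hbd : ∀ x ∈ uIcc x₀ x₁, ∀ y ∈ uIcc y₀ y₁, (x = x₀ ∨ x = x₁ ∨ y = y₀ ∨ y = y₁) →
        ∀ η ∈ insert ω S, ((x : ℝ) + (y : ℝ) * I : ℂ) ≠ η := by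
      rintro x - y - hxy η hη rfl
      have := hS _ hη
      simp only [add_re, ofReal_re, mul_re, I_re, mul_zero, ofReal_im, I_im, mul_one, sub_self,
          add_zero, add_im, mul_im, zero_add, mem_Ioo] at this
      rcases hxy with rfl | rfl | rfl | rfl <;> linarith [this.1.1, this.1.2, this.2.1, this.2.2]
    have hFc : ∀ x ∈ uIcc x₀ x₁, ∀ y ∈ uIcc y₀ y₁, (x = x₀ ∨ x = x₁ ∨ y = y₀ ∨ y = y₁) →
        ContinuousAt F ((x : ℝ) + (y : ℝ) * I) := fun x hx' y hy' hxy =>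
      (hd _ (by simpa [uIcc_of_le hx] using hx') (by simpa [uIcc_of_le hy] using hy')
        fun hmem => hbd x hx' y hy' hxy _ hmem rfl).continuousAt
    have hPc : ∀ x ∈ uIcc x₀ x₁, ∀ y ∈ uIcc y₀ y₁, (x = x₀ ∨ x = x₁ ∨ y = y₀ ∨ y = y₁) →
        ContinuousAt P ((x : ℝ) + (y : ℝ) * I) := fun x hx' y hy' hxy =>
      (hPd _ (hbd x hx' y hy' hxy ω (by simp))).continuousAt
    have hsum : rectIntegral F x₀ x₁ y₀ y₁ =
        rectIntegral G x₀ x₁ y₀ y₁ + rectIntegral P x₀ x₁ y₀ y₁ := by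
      rw [← rectIntegral_add _ hPc]
      · exact rectIntegral_congr fun x hx' y hy' hxy => by
          rw [hGne _ (hbd x hx' y hy' hxy ω (by simp)), sub_add_cancel]
      · exact fun x hx' y hy' hxy => ((hFc x hx' y hy' hxy).sub (hPc x hx' y hy' hxy)).congr
          (hGev _ (hbd x hx' y hy' hxy ω (by simp))).symm
    have hPint : rectIntegral P x₀ x₁ y₀ y₁ = 2 * Real.pi * I * a := by
      have hne := fun x hx' y hy' hxy => hbd x hx' y hy' hxy ω (by simp)
      rw [hP, rectIntegral_add (F := fun z => a * (z - ω)⁻¹) (G := q),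
        rectIntegral_eq_zero_of_hasDerivAt hωr.1 hωr.2 hQ fun z hz => (hq z hz).continuousAt,
        add_zero]
      · rw [← rectIntegral_sub_inv hωr.1 hωr.2]
        simp only [rectIntegral, intervalIntegral.integral_const_mul]
        ring
      · exact fun x hx' y hy' hxy => continuousAt_const.mul
          ((continuousAt_id.sub continuousAt_const).inv₀
            (sub_ne_zero.2 (hne x hx' y hy' hxy)))
      · exact fun x hx' y hy' hxy => (hq _ (hne x hx' y hy' hxy)).continuousAt
    rw [hsum, ih', hPint, Finset.sum_insert hω, residueAt_eq_of_principal_part hh hQ hq he,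
      Finset.sum_congr rfl fun z hz => ?_]
    · ring
    · have hzne := hSne z hz
      rw [residueAt_congr ((hGev z hzne).filter_mono nhdsWithin_le_nhds)]
      simp only [sub_eq_add_neg]
      exact residueAt_add_analytic (hF z (Finset.mem_insert_of_mem hz)) (hPan z hzne).neg

end Residue

/-! ## The Moran function and its zeros -/

theorem Differentiable.finite_zeros_inter {g : ℂ → ℂ} (hg : Differentiable ℂ g) {z₀ : ℂ}
    (h0 : g z₀ ≠ 0) {K : Set ℂ} (hK : IsCompact K) : ({z | g z = 0} ∩ K).Finite := by
  by_contra hinf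
  obtain ⟨z, -, hz⟩ := Set.Infinite.exists_accPt_of_subset_isCompact hinf hK inter_subset_right
  have hfreq : ∃ᶠ y in 𝓝[≠] z, g y = 0 :=
    (accPt_iff_frequently_nhdsNE.1 hz).mono fun y hy => hy.1
  have han : AnalyticOnNhd ℂ g univ := fun z _ => hg.analyticAt z
  exact h0 (han.eqOn_zero_of_preconnected_of_frequently_eq_zero isPreconnected_univ
    (mem_univ z) hfreq (mem_univ z₀))

section Moran

variable {ι : Type*} [Fintype ι]

/-- The Moran function `s ↦ 1 - ∑ i, r_i ^ s`. -/
noncomputable def moran (r : ι → ℝ) (s : ℂ) : ℂ := 1 - ∑ i, (r i : ℂ) ^ s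

variable {r : ι → ℝ}

theorem differentiable_moran (h0 : ∀ i, 0 < r i) : Differentiable ℂ (moran r) := by
  refine (differentiable_const _).sub (Differentiable.fun_sum fun j _ => ?_)
  refine differentiable_id.const_cpow (Or.inl ?_)
  exact_mod_cast (h0 j).ne'

theorem moran_ne_zero (h0 : ∀ i, 0 < r i) {s : ℂ} (hs : ∑ i, r i ^ s.re < 1) :
    moran r s ≠ 0 := by
  intro h
  have h1 : ‖∑ i, (r i : ℂ) ^ s‖ ≤ ∑ i, r i ^ s.re :=
    (norm_sum_le _ _).trans_eq (Finset.sum_congr rfl fun i _ =>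
      Complex.norm_cpow_eq_rpow_re_of_pos (h0 i) s)
  rw [← sub_eq_zero.1 h, norm_one] at h1
  linarith

theorem exists_sum_rpow_lt_one (h0 : ∀ i, 0 < r i) (h1 : ∀ i, r i < 1) :
    ∃ σ : ℝ, ∀ x, σ ≤ x → ∑ i, r i ^ x < 1 := by
  have ht : Tendsto (fun x : ℝ => ∑ j, r j ^ x) atTop (𝓝 (∑ _j : ι, (0 : ℝ))) :=
    tendsto_finsetSum _ fun j _ => tendsto_rpow_atTop_of_base_lt_one _
      (by linarith [h0 j]) (h1 j)
  rw [Finset.sum_const_zero] at ht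
  exact eventually_atTop.1 (ht.eventually_lt_const one_pos)

theorem sum_rpow_lt_one_of_le (h0 : ∀ i, 0 < r i) (h1 : ∀ i, r i < 1) {x y : ℝ} (hxy : x ≤ y)
    (hx : ∑ i, r i ^ x < 1) : ∑ i, r i ^ y < 1 :=
  (Finset.sum_le_sum fun i _ => Real.rpow_le_rpow_of_exponent_ge (h0 i) (h1 i).le hxy).trans_lt hx

/-- Far to the left the smallest ratio dominates the Moran function. -/
theorem exists_moran_lower_bound [Nonempty ι] (h0 : ∀ i, 0 < r i) (h1 : ∀ i, r i < 1) :
    ∃ A : ℝ, ∀ s : ℂ, s.re ≤ A → (⨅ i, r i) ^ s.re ≤ 2 * ‖moran r s‖ := by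
  classical
  obtain ⟨i₀, hi₀⟩ := exists_eq_ciInf_of_finite (f := r)
  have hmin : ∀ i, r i₀ ≤ r i := fun i => hi₀ ▸ ciInf_le (finite_range r).bddBelow i
  rw [← hi₀]
  set ρ := r i₀
  have hρ : 0 < ρ := h0 i₀
  -- After division by `ρ ^ x`, the term `1` and the terms with `r i > ρ` tend to `0` as `x → -∞`.
  -- The ratios equal to `ρ` all have the same phase, so they cannot cancel and contribute `Bᶜ.card
  -- * ρ ^ s` with `Bᶜ.card ≥ 1`.
  set B : Finset ι := Finset.univ.filter fun i => ρ < r i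
  have ht : Tendsto (fun x : ℝ => ρ⁻¹ ^ x + ∑ i ∈ B, (r i / ρ) ^ x) atBot
      (𝓝 (0 + ∑ _i ∈ B, (0 : ℝ))) := by
    refine Tendsto.add (tendsto_rpow_atBot_of_base_gt_one _ ((one_lt_inv₀ hρ).2 (h1 i₀)))
      (tendsto_finsetSum _ fun i hi => tendsto_rpow_atBot_of_base_gt_one _ ?_)
    rw [one_lt_div hρ]
    exact (Finset.mem_filter.1 hi).2
  rw [Finset.sum_const_zero, add_zero] at ht
  obtain ⟨A, hA⟩ := eventually_atBot.1 (ht.eventually_le_const (u := 1 / 2) (by norm_num))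
  refine ⟨A, fun s hs => ?_⟩
  have hx := hA _ hs
  set x := s.re
  have hρx : 0 < ρ ^ x := Real.rpow_pos_of_pos hρ x
  have e1 : 1 + ∑ i ∈ B, r i ^ x ≤ ρ ^ x / 2 := by
    have : ρ⁻¹ ^ x + ∑ i ∈ B, (r i / ρ) ^ x = (1 + ∑ i ∈ B, r i ^ x) / ρ ^ x := by
      rw [Real.inv_rpow hρ.le, add_div, Finset.sum_div, one_div]
      congr 1
      exact Finset.sum_congr rfl fun i _ => Real.div_rpow (h0 i).le hρ.le x
    rw [this, div_le_iff₀ hρx] at hx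
    linarith
  have hsplit : ∑ i, (r i : ℂ) ^ s = ∑ i ∈ B, (r i : ℂ) ^ s + (Bᶜ.card : ℂ) * (ρ : ℂ) ^ s := by
    rw [← Finset.sum_add_sum_compl B]
    congr 1
    rw [← nsmul_eq_mul, ← Finset.sum_const]
    refine Finset.sum_congr rfl fun i hi => ?_
    have : ¬ ρ < r i := by simpa [B] using hi
    rw [le_antisymm (not_lt.1 this) (hmin i)]
  have hcard : (1 : ℝ) ≤ Bᶜ.card := by
    have : i₀ ∈ Bᶜ := by simp [B, ρ]
    exact_mod_cast Finset.card_pos.2 ⟨i₀, this⟩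
  have hn : ‖(Bᶜ.card : ℂ) * (ρ : ℂ) ^ s‖ = Bᶜ.card * ρ ^ x := by
    rw [norm_mul, Complex.norm_natCast, Complex.norm_cpow_eq_rpow_re_of_pos hρ]
  have hB : ‖∑ i ∈ B, (r i : ℂ) ^ s‖ ≤ ∑ i ∈ B, r i ^ x :=
    (norm_sum_le _ _).trans_eq (Finset.sum_congr rfl fun i _ =>
      Complex.norm_cpow_eq_rpow_re_of_pos (h0 i) s)
  have hfin : (Bᶜ.card : ℂ) * (ρ : ℂ) ^ s = 1 - ∑ i ∈ B, (r i : ℂ) ^ s - moran r s := by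
    rw [moran, hsplit]; ring
  have h3 : ‖(Bᶜ.card : ℂ) * (ρ : ℂ) ^ s‖ ≤ 1 + ‖∑ i ∈ B, (r i : ℂ) ^ s‖ + ‖moran r s‖ := by
    rw [hfin]
    have h4 := norm_sub_le (1 : ℂ) (∑ i ∈ B, (r i : ℂ) ^ s)
    rw [norm_one] at h4
    linarith [norm_sub_le (1 - ∑ i ∈ B, (r i : ℂ) ^ s) (moran r s)]
  rw [hn] at h3
  nlinarith

/-- The lower bound on the left and `∑ r_i ^ x < 1` on the right confine the zeros to a vertical
strip; a bounded height makes the region compact. -/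
theorem finite_moran_zeros [Nonempty ι] (h0 : ∀ i, 0 < r i) (h1 : ∀ i, r i < 1) (t : ℝ) :
    ({ω | moran r ω = 0} ∩ {ω | |ω.im| ≤ t}).Finite := by
  obtain ⟨A, hA⟩ := exists_moran_lower_bound h0 h1
  obtain ⟨σ, hσ⟩ := exists_sum_rpow_lt_one h0 h1
  refine ((differentiable_moran h0).finite_zeros_inter (z₀ := (σ : ℂ))
    (moran_ne_zero h0 (hσ _ (by simp))) (K := Icc A σ ×ℂ Icc (-t) t)
    (isCompact_Icc.reProdIm isCompact_Icc)).subset ?_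
  rintro ω ⟨hω, ht⟩
  refine ⟨hω, ⟨?_, ?_⟩, abs_le.1 ht⟩
  · by_contra hlt
    have := hA ω (not_le.1 hlt).le
    rw [show moran r ω = 0 from hω, norm_zero, mul_zero] at this
    obtain ⟨i₀, hi₀⟩ := exists_eq_ciInf_of_finite (f := r)
    exact absurd this (not_le.2 (Real.rpow_pos_of_pos (hi₀ ▸ h0 i₀) _))
  · by_contra hlt
    exact moran_ne_zero h0 (hσ _ (not_le.1 hlt).le) hω

/-- Every window of height one contains a horizontal line on which the Moran function is bounded
below, uniformly in the window; the proof is by compactness of the torus of phases. -/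
theorem exists_moran_line_bound (h0 : ∀ i, 0 < r i) (h1 : ∀ i, r i < 1) (A B : ℝ) :
    ∃ δ > 0, ∀ T : ℝ, ∃ y ∈ Icc T (T + 1), ∀ x ∈ Icc A B, δ ≤ ‖moran r (x + y * Complex.I)‖ := by
  -- Translating `s` by `iT` multiplies `r_i ^ s` by the phase `r_i ^ {iT}`. Allowing arbitrary
  -- phases embeds all vertical translates in a family over a compact torus, so that a bound on `0 ≤
  -- Im s ≤ 1` uniform in `θ` is uniform in `T`.
  set g : (ι → Circle) → ℂ → ℂ := fun θ s => 1 - ∑ i, (r i : ℂ) ^ s * (θ i : ℂ) with hg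
  have hne : ∀ i, (r i : ℂ) ≠ 0 := fun i => by exact_mod_cast (h0 i).ne'
  have hdiff : ∀ θ, Differentiable ℂ (g θ) := fun θ =>
    (differentiable_const _).sub (Differentiable.fun_sum fun j _ =>
      (differentiable_id.const_cpow (Or.inl (hne j))).mul_const _)
  have hcont : Continuous fun p : (ι → Circle) × ℂ => g p.1 p.2 := by
    refine continuous_const.sub (continuous_finsetSum _ fun i _ => Continuous.mul ?_ ?_)
    · exact continuous_snd.const_cpow (Or.inl (hne i))
    · exact continuous_subtype_val.comp ((continuous_apply i).comp continuous_fst)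
  obtain ⟨σ, hσ⟩ := exists_sum_rpow_lt_one h0 h1
  have hnz : ∀ θ, g θ σ ≠ 0 := by
    intro θ h
    have h2 : ‖∑ i, (r i : ℂ) ^ (σ : ℂ) * (θ i : ℂ)‖ ≤ ∑ i, r i ^ σ :=
      (norm_sum_le _ _).trans_eq (Finset.sum_congr rfl fun i _ => by
        rw [norm_mul, Circle.norm_coe, mul_one, Complex.norm_cpow_eq_rpow_re_of_pos (h0 i),
          Complex.ofReal_re])
    rw [← sub_eq_zero.1 h, norm_one] at h2
    linarith [hσ σ le_rfl]
  -- Otherwise every height in `[0, 1]` would carry a zero, whereas there are finitely many zeros in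
  -- the rectangle.
  have hline : ∀ θ, ∃ y ∈ Icc (0 : ℝ) 1, ∀ x ∈ Icc A B, g θ (x + y * Complex.I) ≠ 0 := by
    intro θ
    by_contra! hcon
    have hfin := (hdiff θ).finite_zeros_inter (hnz θ)
      (K := Icc A B ×ℂ Icc 0 1) (isCompact_Icc.reProdIm isCompact_Icc)
    refine (Icc_infinite (zero_lt_one (α := ℝ))) ((hfin.image Complex.im).subset fun y hy => ?_)
    obtain ⟨x, hx, hz⟩ := hcon y hy
    exact ⟨_, ⟨hz, by simpa using hx, by simpa using hy⟩, by simp⟩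
  have hunif : ∃ δ > 0, ∀ θ ∈ (univ : Set (ι → Circle)), ∃ y ∈ Icc (0 : ℝ) 1,
      ∀ x ∈ Icc A B, δ ≤ ‖g θ (x + y * Complex.I)‖ := by
    refine isCompact_univ.induction_on (p := fun S => ∃ δ > 0, ∀ θ ∈ S, ∃ y ∈ Icc (0 : ℝ) 1,
      ∀ x ∈ Icc A B, δ ≤ ‖g θ (x + y * Complex.I)‖) ⟨1, one_pos, by simp⟩ ?_ ?_ ?_
    · rintro s t hst ⟨δ, hδ, h⟩
      exact ⟨δ, hδ, fun θ hθ => h θ (hst hθ)⟩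
    · rintro s t ⟨δ, hδ, h⟩ ⟨δ', hδ', h'⟩
      refine ⟨min δ δ', lt_min hδ hδ', fun θ hθ => ?_⟩
      rcases hθ with hθ | hθ
      · obtain ⟨y, hy, hxy⟩ := h θ hθ
        exact ⟨y, hy, fun x hx => (min_le_left _ _).trans (hxy x hx)⟩
      · obtain ⟨y, hy, hxy⟩ := h' θ hθ
        exact ⟨y, hy, fun x hx => (min_le_right _ _).trans (hxy x hx)⟩
    · intro θ₀ _
      obtain ⟨y, hy, hxy⟩ := hline θ₀
      have hc : Continuous fun p : (ι → Circle) × ℝ => ‖g p.1 (p.2 + y * Complex.I)‖ :=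
        (hcont.comp (continuous_fst.prodMk (by fun_prop))).norm
      obtain ⟨m, hm, hmx⟩ : ∃ m > 0, ∀ x ∈ Icc A B, m < ‖g θ₀ (x + y * Complex.I)‖ := by
        rcases (Icc A B).eq_empty_or_nonempty with he | hnonempty
        · exact ⟨1, one_pos, by simp [he]⟩
        · obtain ⟨x₀, hx₀, hmin⟩ := isCompact_Icc.exists_isMinOn hnonempty
            (hc.comp (Continuous.prodMk_right θ₀)).continuousOn
          have hp : 0 < ‖g θ₀ (x₀ + y * Complex.I)‖ := norm_pos_iff.2 (hxy x₀ hx₀)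
          exact ⟨_, half_pos hp, fun x hx => (half_lt_self hp).trans_le (hmin hx)⟩
      refine ⟨{θ | ∀ x ∈ Icc A B, m < ‖g θ (x + y * Complex.I)‖}, ?_, m, hm,
        fun θ hθ => ⟨y, hy, fun x hx => (hθ x hx).le⟩⟩
      rw [nhdsWithin_univ]
      refine isCompact_Icc.eventually_forall_of_forall_eventually fun x hx => ?_
      exact (hc.tendsto (θ₀, x)).eventually_const_lt (hmx x hx)
  obtain ⟨δ, hδ, h⟩ := hunif
  refine ⟨δ, hδ, fun T => ?_⟩
  obtain ⟨y, hy, hxy⟩ := h (fun i => Circle.exp (Real.log (r i) * T)) (mem_univ _)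
  refine ⟨T + y, ⟨by linarith [hy.1], by linarith [hy.2]⟩, fun x hx => (hxy x hx).trans_eq ?_⟩
  congr 1
  simp only [hg, moran]
  congr 1
  refine Finset.sum_congr rfl fun i _ => ?_
  rw [Circle.coe_exp, Complex.cpow_def_of_ne_zero (hne i), Complex.cpow_def_of_ne_zero (hne i),
    ← Complex.exp_add, ← Complex.ofReal_log (h0 i).le]
  congr 1
  push_cast
  ring

/-- The real ratios give a reflection symmetry, which carries a bound on `Im s = T` over to `Im s =
-T`. -/
theorem norm_moran_conj (h0 : ∀ i, 0 < r i) (s : ℂ) :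
    ‖moran r (starRingEnd ℂ s)‖ = ‖moran r s‖ := by
  have : moran r (starRingEnd ℂ s) = starRingEnd ℂ (moran r s) := by
    simp only [moran, map_sub, map_one, map_sum]
    congr 1
    refine Finset.sum_congr rfl fun i _ => ?_
    have harg : (r i : ℂ).arg ≠ Real.pi := by
      rw [Complex.arg_ofReal_of_nonneg (h0 i).le]
      exact Real.pi_pos.ne
    rw [Complex.cpow_conj _ _ harg, Complex.conj_ofReal]
  rw [this, Complex.norm_conj]

/-- Both lower bounds are put in the common form needed on the contours: for `A < Re s ≤ c` the left
side is at most `ρ ^ A`, so the constant bound `δ` suffices there. The linear upper bound on `T n`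
controls the length of the left edge, the lower bound gives decay on the horizontal edges. -/
theorem exists_moran_contours [Nonempty ι] (h0 : ∀ i, 0 < r i) (h1 : ∀ i, r i < 1) (c : ℝ) :
    ∃ T : ℕ → ℝ, StrictMono T ∧ Tendsto T atTop atTop ∧
      (∀ n : ℕ, (n : ℝ) + 1 ≤ T n ∧ T n ≤ 2 * n + 3) ∧
      ∃ K > 0, ∃ A : ℝ, ∀ s : ℂ, s.re ≤ c → (s.re ≤ A ∨ ∃ n, |s.im| = T n) →
        (⨅ i, r i) ^ s.re ≤ K * ‖moran r s‖ := by
  obtain ⟨A, hA⟩ := exists_moran_lower_bound h0 h1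
  obtain ⟨δ, hδ, hl⟩ := exists_moran_line_bound h0 h1 A c
  choose y hy hb using hl
  -- The windows `[2n + 2, 2n + 3]` are disjoint, whence strict monotonicity.
  set T : ℕ → ℝ := fun n => y (2 * n + 2)
  have hT : ∀ n : ℕ, 2 * (n : ℝ) + 2 ≤ T n ∧ T n ≤ 2 * n + 3 := fun n =>
    ⟨(hy (2 * n + 2)).1, by linarith [(hy (2 * (n : ℝ) + 2)).2]⟩
  have hT1 : ∀ n : ℕ, (n : ℝ) + 1 ≤ T n := fun n => by
    have := (hT n).1
    have h : (0 : ℝ) ≤ n := n.cast_nonneg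
    linarith
  obtain ⟨i₀, hi₀⟩ := exists_eq_ciInf_of_finite (f := r)
  rw [← hi₀]
  have hρ := h0 i₀
  refine ⟨T, strictMono_nat_of_lt_succ fun n => ?_, ?_, fun n => ⟨hT1 n, (hT n).2⟩,
    max 2 (r i₀ ^ A / δ), lt_max_of_lt_left two_pos, A, fun s hs h => ?_⟩
  · have := (hT (n + 1)).1
    push_cast at this
    linarith [(hT n).2]
  · exact tendsto_atTop_mono (fun n => (lt_add_one _).le.trans (hT1 n)) tendsto_natCast_atTop_atTop
  · by_cases hsA : s.re ≤ A
    · exact (hi₀ ▸ hA s hsA).trans (mul_le_mul_of_nonneg_right (le_max_left _ _) (norm_nonneg _))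
    · obtain ⟨n, hn⟩ := h.resolve_left hsA
      push Not at hsA
      have hbs : δ ≤ ‖moran r s‖ := by
        have := hb (2 * n + 2) s.re ⟨hsA.le, hs⟩
        rcases abs_choice s.im with h' | h' <;> rw [h'] at hn
        · rwa [show y (2 * n + 2) = s.im from hn.symm, Complex.re_add_im] at this
        · rw [show y (2 * n + 2) = -s.im from hn.symm, ← norm_moran_conj h0] at this
          convert this using 3
          apply Complex.ext <;> simp
      calc r i₀ ^ s.re ≤ r i₀ ^ A :=
            Real.rpow_le_rpow_of_exponent_ge hρ (h1 i₀).le hsA.le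
        _ = r i₀ ^ A / δ * δ := by field_simp
        _ ≤ _ := mul_le_mul (le_max_right _ _) hbs hδ.le (le_max_of_le_left two_pos.le)

end Moran

/-! ## The scaling zeta function -/

namespace SelfSimilarSystem

variable {d J : ℕ} (Φ : SelfSimilarSystem d J)

theorem nonempty_fin {d J : ℕ} (Φ : SelfSimilarSystem d J) : Nonempty (Fin J) :=
  ⟨⟨0, two_pos.trans_le Φ.two_le⟩⟩

theorem wordRatio_cons (j : Fin J) (w : List (Fin J)) :
    Φ.wordRatio (j :: w) = Φ.ratio j * Φ.wordRatio w := by simp [wordRatio]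

theorem wordRatio_pos (w : List (Fin J)) : 0 < Φ.wordRatio w := by
  induction w with
  | nil => exact one_pos
  | cons j w ih => rw [wordRatio_cons]; exact mul_pos (Φ.ratio_pos j) ih

/-- Words of length `n` add up to `(∑ j, a j) ^ n`, and the lengths form a geometric series; the
same computation with norms gives absolute convergence. -/
theorem hasSum_prod_words {J : ℕ} {a : Fin J → ℂ} (ha : ∑ j, ‖a j‖ < 1) :
    HasSum (fun w : List (Fin J) => (w.map a).prod) (1 - ∑ j, a j)⁻¹ := by
  have hpow : ∀ {R : Type} [CommSemiring R] (b : Fin J → R) (n : ℕ),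
      ∑ f : Fin n → Fin J, ((List.ofFn f).map b).prod = (∑ j, b j) ^ n := by
    intro R _ b n
    rw [Finset.sum_pow', Fintype.piFinset_univ]
    refine Finset.sum_congr rfl fun f _ => ?_
    rw [List.map_ofFn, List.prod_ofFn]
    rfl
  have hnorm : ∀ w : List (Fin J), ‖(w.map a).prod‖ = (w.map fun j => ‖a j‖).prod := by
    intro w
    induction w with
    | nil => simp
    | cons j w ih => simp [ih]
  have hsum : Summable fun p : (n : ℕ) × (Fin n → Fin J) => ((List.ofFn p.2).map a).prod := by
    refine Summable.of_norm ?_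
    rw [summable_sigma_of_nonneg fun _ => norm_nonneg _]
    refine ⟨fun n => (hasSum_fintype _).summable, ?_⟩
    simp only [tsum_fintype, hnorm, hpow]
    exact summable_geometric_of_lt_one (Finset.sum_nonneg fun _ _ => norm_nonneg _) ha
  have hlt : ‖∑ j, a j‖ < 1 := (norm_sum_le _ _).trans_lt ha
  have h2 := hsum.hasSum.sigma fun n => hasSum_fintype _
  simp only [hpow] at h2
  have h4 := hsum.hasSum
  rw [h2.unique (hasSum_geometric_of_norm_lt_one hlt)] at h4
  exact (Equiv.hasSum_iff List.equivSigmaTuple.symm).1 h4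

theorem wordRatio_cpow (w : List (Fin J)) (s : ℂ) :
    (Φ.wordRatio w : ℂ) ^ s = (w.map fun j => (Φ.ratio j : ℂ) ^ s).prod := by
  induction w with
  | nil => simp [wordRatio]
  | cons j w ih =>
    rw [List.map_cons, List.prod_cons, ← ih, wordRatio_cons, Complex.ofReal_mul]
    exact Complex.mul_cpow_ofReal_nonneg (Φ.ratio_pos j).le (Φ.wordRatio_pos w).le s

theorem hasSum_wordRatio_cpow {s : ℂ} (hs : ∑ j, Φ.ratio j ^ s.re < 1) :
    HasSum (fun w : List (Fin J) => (Φ.wordRatio w : ℂ) ^ s) (moran Φ.ratio s)⁻¹ := by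
  simp only [wordRatio_cpow]
  refine hasSum_prod_words ?_
  simpa only [Complex.norm_cpow_eq_rpow_re_of_pos (Φ.ratio_pos _)] using hs

theorem summable_wordRatio_rpow {x : ℝ} (hx : ∑ j, Φ.ratio j ^ x < 1) :
    Summable fun w : List (Fin J) => Φ.wordRatio w ^ x := by
  have h := (Φ.hasSum_wordRatio_cpow (s := x) (by simpa using hx)).summable.norm
  simpa only [Complex.norm_cpow_eq_rpow_re_of_pos (Φ.wordRatio_pos _), Complex.ofReal_re] using h

/-- The two functions agree on a half-plane, hence off a discrete set by the identity theorem for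
meromorphic functions. Normal form upgrades this to equality everywhere, poles included, where both
take the value `0`. -/
theorem scalingZeta_eq : Φ.scalingZeta = (moran Φ.ratio)⁻¹ := by
  obtain ⟨hNF, σ, hσ⟩ := Φ.exists_isScalingZeta.choose_spec
  change MeromorphicNFOn Φ.scalingZeta univ at hNF
  change ∀ s : ℂ, σ < s.re → HasSum _ (Φ.scalingZeta s) at hσ
  have han : ∀ z, AnalyticAt ℂ (moran Φ.ratio) z := (differentiable_moran Φ.ratio_pos).analyticAt
  have hNF' : ∀ z, MeromorphicNFAt (moran Φ.ratio)⁻¹ z := fun z => (han z).meromorphicNFAt.inv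
  obtain ⟨τ, hτ⟩ := exists_sum_rpow_lt_one Φ.ratio_pos Φ.ratio_lt_one
  set z₀ : ℂ := ((max σ τ + 1 : ℝ) : ℂ)
  have hev : ∀ᶠ z in 𝓝 z₀, (Φ.scalingZeta - (moran Φ.ratio)⁻¹) z = 0 := by
    have : ∀ᶠ z : ℂ in 𝓝 z₀, max σ τ < z.re :=
      Complex.continuous_re.continuousAt.eventually_const_lt (by simp [z₀])
    filter_upwards [this] with z hz
    rw [Pi.sub_apply, Pi.inv_apply, (hσ z ((le_max_left _ _).trans_lt hz)).unique
      (Φ.hasSum_wordRatio_cpow (hτ _ ((le_max_right _ _).trans hz.le))), sub_self]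
  have hmer : MeromorphicOn (Φ.scalingZeta - (moran Φ.ratio)⁻¹) univ := fun z _ =>
    (hNF (mem_univ z)).meromorphicAt.sub (hNF' z).meromorphicAt
  funext z
  have htop : meromorphicOrderAt (Φ.scalingZeta - (moran Φ.ratio)⁻¹) z = ⊤ := by
    by_contra hne
    exact hmer.meromorphicOrderAt_ne_top_of_isPreconnected isPreconnected_univ (mem_univ z)
      (mem_univ z₀) hne (meromorphicOrderAt_eq_top_iff.2 (hev.filter_mono nhdsWithin_le_nhds))
  have h1 : Φ.scalingZeta =ᶠ[𝓝[≠] z] (moran Φ.ratio)⁻¹ := by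
    filter_upwards [meromorphicOrderAt_eq_top_iff.1 htop] with y hy using sub_eq_zero.1 hy
  exact (((hNF (mem_univ z)).eventuallyEq_nhdsNE_iff_eventuallyEq_nhds (hNF' z)).1 h1).eq_of_nhds

theorem scalingDimensions_eq : Φ.scalingDimensions = {ω | moran Φ.ratio ω = 0} := by
  have hd := differentiable_moran Φ.ratio_pos
  obtain ⟨τ, hτ⟩ := exists_sum_rpow_lt_one Φ.ratio_pos Φ.ratio_lt_one
  ext ω
  rw [scalingDimensions, mem_ofPred_eq, scalingZeta_eq, meromorphicOrderAt_inv, mem_ofPred_eq,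
    (hd.analyticAt ω).meromorphicOrderAt_eq]
  by_cases h : moran Φ.ratio ω = 0
  · have h0 : analyticOrderAt (moran Φ.ratio) ω ≠ 0 := (hd.analyticAt ω).analyticOrderAt_ne_zero.2 h
    have han : AnalyticOnNhd ℂ (moran Φ.ratio) univ := fun z _ => hd.analyticAt z
    have ht : analyticOrderAt (moran Φ.ratio) ω ≠ ⊤ := fun htop =>
      moran_ne_zero Φ.ratio_pos (s := τ) (hτ _ (by simp))
        (han.eqOn_zero_of_preconnected_of_eventuallyEq_zero
          isPreconnected_univ (mem_univ ω) (analyticOrderAt_eq_top.1 htop) (mem_univ (τ : ℂ)))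
    obtain ⟨n, hn⟩ := ENat.ne_top_iff_exists.1 ht
    rw [← hn] at h0 ⊢
    have hn0 : n ≠ 0 := by exact_mod_cast h0
    simp only [h, iff_true, ENat.map_natCast]
    change ((-(n : ℤ) : ℤ) : WithTop ℤ) < ((0 : ℤ) : WithTop ℤ)
    rw [WithTop.coe_lt_coe]
    omega
  · rw [(hd.analyticAt ω).analyticOrderAt_eq_zero.2 h]
    simp [h]

theorem finite_complexDimensions_inter (t : ℝ) :
    (Φ.complexDimensions ∩ {ω | |ω.im| ≤ t}).Finite := by
  have := Φ.nonempty_fin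
  rw [complexDimensions, scalingDimensions_eq, union_inter_distrib_right]
  refine (finite_moran_zeros Φ.ratio_pos Φ.ratio_lt_one t).union (Finite.inter_of_left ?_ _)
  refine ((finite_Iio d).image fun k : ℕ => (k : ℂ)).subset ?_
  rintro _ ⟨k, hk, rfl⟩
  exact ⟨k, hk, rfl⟩

end SelfSimilarSystem

/-! ## Mellin transforms of test functions -/

section TestFunction

variable {φ : ℝ → ℂ} {a b : ℝ}

theorem eq_zero_of_notMem_Icc (hs : tsupport φ ⊆ Icc a b) {x : ℝ} (hx : x ∉ Icc a b) : φ x = 0 :=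
  image_eq_zero_of_notMem_tsupport fun h => hx (hs h)

theorem eventually_nhds_zero_eq_zero (ha : 0 < a) (hs : tsupport φ ⊆ Icc a b) :
    ∀ᶠ x in 𝓝 (0 : ℝ), φ x = 0 := by
  filter_upwards [Iio_mem_nhds ha] with x hx
  exact eq_zero_of_notMem_Icc hs fun h => absurd hx (not_lt.2 h.1)

theorem eventually_atTop_eq_zero (hs : tsupport φ ⊆ Icc a b) : ∀ᶠ x in atTop, φ x = 0 := by
  filter_upwards [Ioi_mem_atTop b] with x hx
  exact eq_zero_of_notMem_Icc hs fun h => absurd hx (not_lt.2 h.2)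

theorem isBigO_atTop_of_tsupport_subset (hs : tsupport φ ⊆ Icc a b) (p : ℝ) :
    φ =O[atTop] (fun x : ℝ => x ^ p) :=
  (Asymptotics.isBigO_zero _ _).congr' ((eventually_atTop_eq_zero hs).mono fun _ hx => hx.symm)
    .rfl

theorem isBigO_nhdsGT_of_tsupport_subset (ha : 0 < a) (hs : tsupport φ ⊆ Icc a b) (p : ℝ) :
    φ =O[𝓝[>] 0] (fun x : ℝ => x ^ p) :=
  (Asymptotics.isBigO_zero _ _).congr'
    (((eventually_nhds_zero_eq_zero ha hs).filter_mono nhdsWithin_le_nhds).mono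
      fun _ hx => hx.symm) .rfl

theorem mellinConvergent_test (hc : Continuous φ) (ha : 0 < a) (hs : tsupport φ ⊆ Icc a b)
    (z : ℂ) : MellinConvergent φ z :=
  mellinConvergent_of_isBigO_rpow (hc.locallyIntegrable.locallyIntegrableOn _)
    (isBigO_atTop_of_tsupport_subset hs _) (lt_add_one z.re)
    (isBigO_nhdsGT_of_tsupport_subset ha hs _) (sub_one_lt z.re)

theorem differentiable_mellin_test (hc : Continuous φ) (ha : 0 < a) (hs : tsupport φ ⊆ Icc a b) :
    Differentiable ℂ (mellin φ) := fun z =>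
  mellin_differentiableAt_of_isBigO_rpow (hc.locallyIntegrable.locallyIntegrableOn _)
    (isBigO_atTop_of_tsupport_subset hs _) (lt_add_one z.re)
    (isBigO_nhdsGT_of_tsupport_subset ha hs _) (sub_one_lt z.re)

/-- Integration by parts; the boundary terms vanish since `φ` is zero near `0` and near infinity. -/
theorem mul_mellin_test (hφ : ContDiff ℝ 1 φ) (ha : 0 < a) (hs : tsupport φ ⊆ Icc a b) (z : ℂ) :
    z * mellin φ z = -mellin (deriv φ) (z + 1) := by
  have hs' : tsupport (deriv φ) ⊆ Icc a b := tsupport_deriv_subset.trans hs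
  have hc' : Continuous (deriv φ) := hφ.continuous_deriv le_rfl
  have i1 : IntegrableOn (fun t : ℝ => z * ((t : ℂ) ^ (z - 1) • φ t)) (Ioi 0) :=
    Integrable.const_mul (mellinConvergent_test hφ.continuous ha hs z) z
  have i2 : IntegrableOn (fun t : ℝ => (t : ℂ) ^ (z + 1 - 1) • deriv φ t) (Ioi 0) :=
    mellinConvergent_test hc' ha hs' (z + 1)
  have h0 : (0 : ℝ) ∉ Icc a b := fun h => absurd h.1 (not_le.2 ha)
  have key := integral_Ioi_of_hasDerivAt_of_tendsto (a := 0) (m := 0)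
    (f := fun t : ℝ => (t : ℂ) ^ z * φ t)
    (f' := fun t : ℝ => z * ((t : ℂ) ^ (z - 1) • φ t) + (t : ℂ) ^ (z + 1 - 1) • deriv φ t)
    ?_ ?_ (i1.add i2) ?_
  · rw [integral_add i1 i2, integral_const_mul, eq_zero_of_notMem_Icc hs h0, mul_zero,
      sub_zero] at key
    exact eq_neg_of_add_eq_zero_left key
  · refine ContinuousAt.continuousWithinAt ?_
    refine (continuousAt_const (y := (0 : ℂ))).congr ?_
    filter_upwards [eventually_nhds_zero_eq_zero ha hs] with x hx
    rw [hx, mul_zero]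
  · intro t ht
    have h1 : HasDerivAt (fun t : ℝ => (t : ℂ) ^ z) (z * (t : ℂ) ^ (z - 1)) t := by
      have := (hasDerivAt_id (t : ℂ)).cpow_const (c := z) (Or.inl (by simpa using ht))
      simpa using this.comp_ofReal
    have h2 := h1.mul ((hφ.differentiable one_ne_zero) t).hasDerivAt
    refine h2.congr_deriv ?_
    simp only [smul_eq_mul, add_sub_cancel_right]
    ring
  · refine tendsto_const_nhds.congr' ?_
    filter_upwards [eventually_atTop_eq_zero hs] with x hx
    rw [hx, mul_zero]

theorem exists_mellin_test_le (hc : Continuous φ) (ha : 0 < a) (hs : tsupport φ ⊆ Icc a b)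
    (p : ℝ) : ∃ C, ∀ z : ℂ, p ≤ z.re → ‖mellin φ z‖ ≤ C * b ^ (z.re - p) := by
  refine ⟨∫ t in Ioi (0 : ℝ), ‖(t : ℂ) ^ ((p : ℂ) - 1) • φ t‖, fun z hz => ?_⟩
  rw [← integral_mul_const]
  refine norm_integral_le_of_norm_le ((mellinConvergent_test hc ha hs p).norm.mul_const _) ?_
  filter_upwards [ae_restrict_mem measurableSet_Ioi] with t ht
  have ht' : 0 < t := ht
  rw [norm_smul, norm_smul, Complex.norm_cpow_eq_rpow_re_of_pos ht',
    Complex.norm_cpow_eq_rpow_re_of_pos ht']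
  by_cases h : t ∈ Icc a b
  · have : t ^ (z - 1).re ≤ t ^ ((p : ℂ) - 1).re * b ^ (z.re - p) := by
      have e : (z - 1).re = ((p : ℂ) - 1).re + (z.re - p) := by simp
      rw [e, Real.rpow_add ht']
      gcongr
      exact h.2
    calc _ ≤ t ^ ((p : ℂ) - 1).re * b ^ (z.re - p) * ‖φ t‖ := by gcongr
      _ = _ := by ring
  · rw [eq_zero_of_notMem_Icc hs h]
    simp

/-- Two integrations by parts gain the factor `z (z + 1)`, of modulus at least `(Im z)^2`. The exact
exponential rate `b ^ Re z`, set by the right end of the support, later decides where the tube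
formula holds. -/
theorem exists_mellin_test_decay (hφ : ContDiff ℝ (⊤ : ℕ∞) φ) (ha : 0 < a) (hab : a ≤ b)
    (hs : tsupport φ ⊆ Icc a b) (p : ℝ) :
    ∃ C, ∀ z : ℂ, p ≤ z.re → (1 + z.im ^ 2) * ‖mellin φ z‖ ≤ C * b ^ z.re := by
  have hb : 0 < b := ha.trans_le hab
  have hφ' : ContDiff ℝ (⊤ : ℕ∞) (deriv φ) := ((contDiff_infty_iff_deriv (𝕜 := ℝ)).1 hφ).2
  have hs' : tsupport (deriv φ) ⊆ Icc a b := tsupport_deriv_subset.trans hs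
  have hs'' : tsupport (deriv (deriv φ)) ⊆ Icc a b := tsupport_deriv_subset.trans hs'
  have h1 : ContDiff ℝ 1 φ := hφ.of_le (by exact_mod_cast le_top)
  have h1' : ContDiff ℝ 1 (deriv φ) := hφ'.of_le (by exact_mod_cast le_top)
  obtain ⟨C₀, hC₀⟩ := exists_mellin_test_le h1.continuous ha hs p
  obtain ⟨C₂, hC₂⟩ := exists_mellin_test_le (h1'.continuous_deriv le_rfl) ha hs'' p
  refine ⟨C₀ * b ^ (-p) + C₂ * b ^ (2 - p), fun z hz => ?_⟩
  have e : z * (z + 1) * mellin φ z = mellin (deriv (deriv φ)) (z + 2) := by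
    have e1 := mul_mellin_test h1 ha hs z
    have e2 := mul_mellin_test h1' ha hs' (z + 1)
    rw [show z + 1 + 1 = z + 2 by ring] at e2
    linear_combination (z + 1) * e1 - e2
  have hle : z.im ^ 2 ≤ ‖z * (z + 1)‖ := by
    rw [norm_mul, ← sq_abs, sq]
    have h2 := Complex.abs_im_le_norm (z + 1)
    rw [Complex.add_im, Complex.one_im, add_zero] at h2
    exact mul_le_mul (Complex.abs_im_le_norm z) h2 (abs_nonneg _) (norm_nonneg _)
  have b0 := hC₀ z hz
  have b2 := hC₂ (z + 2) (by simp; linarith)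
  rw [← e, norm_mul] at b2
  have b2' := (mul_le_mul_of_nonneg_right hle (norm_nonneg (mellin φ z))).trans b2
  have r0 : b ^ (z.re - p) = b ^ (-p) * b ^ z.re := by
    rw [← Real.rpow_add hb]; congr 1; ring
  have r2 : b ^ ((z + 2).re - p) = b ^ (2 - p) * b ^ z.re := by
    rw [← Real.rpow_add hb]; congr 1; simp; ring
  rw [r0] at b0
  rw [r2] at b2'
  linarith

theorem verticalIntegrable_mellin_test (hφ : ContDiff ℝ (⊤ : ℕ∞) φ) (ha : 0 < a) (hab : a ≤ b)
    (hs : tsupport φ ⊆ Icc a b) (p : ℝ) :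
    Integrable fun y : ℝ => mellin φ (p + y * Complex.I) := by
  obtain ⟨C, hC⟩ := exists_mellin_test_decay hφ ha hab hs p
  have hcont : Continuous fun y : ℝ => mellin φ (p + y * Complex.I) :=
    (differentiable_mellin_test hφ.continuous ha hs).continuous.comp (by fun_prop)
  refine (integrable_inv_one_add_sq.const_mul (C * b ^ p)).mono' hcont.aestronglyMeasurable
    (ae_of_all _ fun y => ?_)
  have h := hC (p + y * Complex.I) (by simp)
  have hre : ((p : ℂ) + y * Complex.I).re = p := by simp
  have him : ((p : ℂ) + y * Complex.I).im = y := by simp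
  rw [hre, him] at h
  rw [← div_eq_mul_inv, le_div_iff₀ (by positivity), mul_comm]
  exact h

theorem mellin_inversion_test (hφ : ContDiff ℝ (⊤ : ℕ∞) φ) (ha : 0 < a) (hab : a ≤ b)
    (hs : tsupport φ ⊆ Icc a b) (p : ℝ) {x : ℝ} (hx : 0 < x) :
    φ x = (1 / (2 * Real.pi) : ℝ) •
      ∫ y : ℝ, (x : ℂ) ^ (-((p : ℂ) + y * Complex.I)) * mellin φ (p + y * Complex.I) :=
  (mellinInv_mellin_eq p φ hx (mellinConvergent_test hφ.continuous ha hs _)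
    (verticalIntegrable_mellin_test hφ ha hab hs p) hφ.continuous.continuousAt).symm

end TestFunction

/-! ## Convex hulls of compact sets -/

/-- By Carathéodory, `dim + 1` points suffice for each convex combination, so the hull is a
continuous image of a simplex times a power of `s`. -/
theorem IsCompact.convexHull_of_finiteDimensional {E : Type*} [NormedAddCommGroup E]
    [NormedSpace ℝ E] [FiniteDimensional ℝ E] {s : Set E} (hs : IsCompact s) :
    IsCompact (convexHull ℝ s) := by
  set n := Module.finrank ℝ E + 1
  have himage : convexHull ℝ s = (fun p : (Fin n → ℝ) × (Fin n → E) => ∑ i, p.1 i • p.2 i) ''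
      (stdSimplex ℝ (Fin n) ×ˢ univ.pi fun _ => s) := by
    apply Subset.antisymm
    · intro x hx
      rw [convexHull_eq_union] at hx
      simp only [mem_iUnion] at hx
      obtain ⟨t, hts, hind, hxt⟩ := hx
      obtain ⟨x₀, hx₀⟩ : (t : Set E).Nonempty := convexHull_nonempty_iff.1 ⟨x, hxt⟩
      have hcard : t.card ≤ n := by
        have h := hind.card_le_finrank_succ
        rw [Fintype.card_coe] at h
        exact h.trans (Nat.succ_le_succ (Submodule.finrank_le _))
      -- Smaller families are padded with a repeated point of `t`.
      set f : Fin n → E := fun i => if h : (i : ℕ) < t.card then t.equivFin.symm ⟨i, h⟩ else x₀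
      have hft : ∀ i, f i ∈ (t : Set E) := by
        intro i
        by_cases h : (i : ℕ) < t.card
        · simp [f, h]
        · simpa [f, h] using hx₀
      have hsub : convexHull ℝ (t : Set E) ⊆
          Fintype.linearCombination ℝ f '' stdSimplex ℝ (Fin n) := by
        refine convexHull_min ?_ ((convex_stdSimplex ℝ _).linear_image _)
        intro y hy
        refine ⟨Pi.single ⟨t.equivFin ⟨y, hy⟩, (t.equivFin ⟨y, hy⟩).2.trans_le hcard⟩ 1,
          single_mem_stdSimplex ℝ _, ?_⟩
        rw [Fintype.linearCombination_apply_single, one_smul]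
        simp [f]
      obtain ⟨w, hw, hwx⟩ := hsub hxt
      refine ⟨(w, f), ⟨hw, fun i _ => hts (hft i)⟩, ?_⟩
      rw [← hwx, Fintype.linearCombination_apply]
    · rintro _ ⟨⟨w, f⟩, ⟨hw, hf⟩, rfl⟩
      exact (convex_convexHull ℝ s).sum_mem (fun i _ => hw.1 i) hw.2
        fun i _ => subset_convexHull ℝ s (hf i (mem_univ i))
  rw [himage]
  refine IsCompact.image ((isCompact_stdSimplex ℝ _).prod (isCompact_univ_pi fun _ => hs)) ?_
  exact continuous_finsetSum _ fun i _ => ((continuous_apply i).comp continuous_fst).smul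
    ((continuous_apply i).comp continuous_snd)

theorem intrinsicInterior_eq_interior {E : Type*} [NormedAddCommGroup E] [NormedSpace ℝ E]
    {s : Set E} (hs : (interior s).Nonempty) : intrinsicInterior ℝ s = interior s := by
  refine Subset.antisymm ?_ interior_subset_intrinsicInterior
  refine interior_maximal intrinsicInterior_subset ?_
  have hopen : IsOpen ((affineSpan ℝ s : AffineSubspace ℝ E) : Set E) := by
    rw [affineSpan_eq_top_of_nonempty_interior (hs.mono (interior_mono (subset_convexHull ℝ s)))]
    exact isOpen_univ
  exact hopen.isOpenMap_subtype_val _ isOpen_interior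

/-! ## Inner tube volumes -/

section Tube

variable {d : ℕ}

local notation "E" => EuclideanSpace ℝ (Fin d)

/-- A nearest point of the complement lies on the frontier. Distances to complements are monotone in
the set, which distances to frontiers are not in general. -/
theorem infDist_frontier_eq_infDist_compl {A : Set E} (hA : IsOpen A) (hu : A ≠ univ) {x : E}
    (hx : x ∈ A) : Metric.infDist x (frontier A) = Metric.infDist x Aᶜ := by
  refine le_antisymm ?_ (Metric.infDist_le_infDist_of_subset ?_
    (nonempty_frontier_iff.2 ⟨⟨x, hx⟩, hu⟩))
  · obtain ⟨y, hy, hxy⟩ := exists_mem_frontier_infDist_compl_eq_dist hx hu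
    rw [hxy]
    exact Metric.infDist_le_dist_of_mem hy
  · rw [hA.frontier_eq]
    exact fun y hy => hy.2

theorem innerNeighbourhood_subset (A : Set E) (ε : ℝ) : innerNeighbourhood A ε ⊆ A :=
  fun _ hx => hx.1

theorem measurableSet_innerNeighbourhood {A : Set E} (hA : IsOpen A) (ε : ℝ) :
    MeasurableSet (innerNeighbourhood A ε) :=
  hA.measurableSet.inter
    (isClosed_le (Metric.continuous_infDist_pt _) continuous_const).measurableSet

theorem monotone_innerTubeVolume {A : Set E} (hA : volume A ≠ ∞) : Monotone (innerTubeVolume A) :=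
  fun _ _ h => measureReal_mono (fun _ hx => ⟨hx.1, hx.2.trans h⟩)
    (measure_ne_top_of_subset (innerNeighbourhood_subset _ _) hA)

/-- The supremum of an unbounded set of reals has the default value `0`, so positivity rules that
case out. -/
theorem bddAbove_radii_of_inradius_pos {A : Set E} (h : 0 < inradius A) :
    BddAbove {ε : ℝ | 0 < ε ∧ ∃ x, Metric.ball x ε ⊆ A} := by
  by_contra hb
  exact h.ne' (Real.sSup_of_not_bddAbove hb)

/-- The ball about `x` of radius `dist (x, Aᶜ)` lies in `A`, so no point is farther from the
boundary than the inradius. -/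
theorem innerTubeVolume_of_inradius_le {A : Set E} (hA : IsOpen A) (h : 0 < inradius A) {ε : ℝ}
    (hε : inradius A ≤ ε) : innerTubeVolume A ε = volume.real A := by
  have hb := bddAbove_radii_of_inradius_pos h
  have hu : A ≠ univ := by
    rintro rfl
    obtain ⟨M, hM⟩ := hb
    have : |M| + 1 ≤ M := hM ⟨by positivity, 0, subset_univ _⟩
    linarith [le_abs_self M]
  unfold innerTubeVolume
  congr 1
  refine Subset.antisymm (innerNeighbourhood_subset _ _) fun x hx => ⟨hx, ?_⟩
  rw [infDist_frontier_eq_infDist_compl hA hu hx]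
  refine le_trans ?_ hε
  rcases Metric.infDist_nonneg.eq_or_lt' (a := Metric.infDist x Aᶜ) with h0 | h0
  · rw [h0]; exact h.le
  · exact le_csSup hb ⟨h0, x, Metric.ball_infDist_compl_subset⟩

theorem exists_ball_subset_of_inradius_pos {A : Set E} (h : 0 < inradius A) :
    ∃ x ε, 0 < ε ∧ Metric.ball x ε ⊆ A := by
  by_contra! hcon
  have : {ε : ℝ | 0 < ε ∧ ∃ x, Metric.ball x ε ⊆ A} = ∅ := by
    ext ε
    simp only [mem_ofPred_eq, mem_empty_iff_false, iff_false, not_and, not_exists]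
    exact fun hε x => hcon x ε hε
  rw [inradius, this, Real.sSup_empty] at h
  exact h.false

/-- The inner neighbourhood of a disjoint union of open sets. -/
theorem innerNeighbourhood_iUnion {ι : Type*} {R : ι → Set E} (ho : ∀ i, IsOpen (R i))
    (hd : Pairwise (Function.onFun Disjoint R)) (hu : ⋃ i, R i ≠ univ) (ε : ℝ) :
    innerNeighbourhood (⋃ i, R i) ε = ⋃ i, innerNeighbourhood (R i) ε := by
  have hA : IsOpen (⋃ i, R i) := isOpen_iUnion ho
  have hu' : ∀ i, R i ≠ univ := fun i h => hu (univ_subset_iff.1 (h ▸ subset_iUnion R i))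
  have key : ∀ i, ∀ x ∈ R i,
      Metric.infDist x (frontier (⋃ i, R i)) = Metric.infDist x (frontier (R i)) := by
    intro i x hx
    have hxU := mem_iUnion_of_mem i hx
    -- A frontier point of `R i` inside another piece `R j` would have the open set `R j` as a
    -- neighbourhood, and `R j` would meet `R i`.
    have hfr : frontier (R i) ⊆ frontier (⋃ i, R i) := by
      rw [hA.frontier_eq, (ho i).frontier_eq]
      rintro y ⟨hy, hyi⟩
      refine ⟨closure_mono (subset_iUnion R i) hy, fun hyU => ?_⟩
      obtain ⟨j, hj⟩ := mem_iUnion.1 hyU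
      have hij : i ≠ j := by rintro rfl; exact hyi hj
      obtain ⟨z, hz, hz'⟩ := mem_closure_iff.1 hy _ (ho j) hj
      exact (hd hij).ne_of_mem hz' hz rfl
    refine le_antisymm (Metric.infDist_le_infDist_of_subset hfr
      (nonempty_frontier_iff.2 ⟨⟨x, hx⟩, hu' i⟩)) ?_
    rw [infDist_frontier_eq_infDist_compl hA hu hxU,
      infDist_frontier_eq_infDist_compl (ho i) (hu' i) hx]
    exact Metric.infDist_le_infDist_of_subset (compl_subset_compl.2 (subset_iUnion R i))
      (nonempty_compl.2 hu)
  ext x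
  simp only [innerNeighbourhood, mem_iUnion, mem_ofPred_eq]
  constructor
  · rintro ⟨⟨i, hi⟩, h⟩
    exact ⟨i, hi, key i x hi ▸ h⟩
  · rintro ⟨i, hi, h⟩
    exact ⟨⟨i, hi⟩, (key i x hi).symm ▸ h⟩

theorem infDist_image_of_dist_eq {X Y : Type*} [PseudoMetricSpace X] [PseudoMetricSpace Y]
    {h : X → Y} {r : ℝ} (hr : 0 < r) (hd : ∀ x y, dist (h x) (h y) = r * dist x y) (x : X)
    {s : Set X} (hs : s.Nonempty) :
    Metric.infDist (h x) (h '' s) = r * Metric.infDist x s := by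
  apply le_antisymm
  · rw [← div_le_iff₀' hr, Metric.le_infDist hs]
    intro y hy
    rw [div_le_iff₀' hr, ← hd]
    exact Metric.infDist_le_dist_of_mem (mem_image_of_mem h hy)
  · rw [Metric.le_infDist (hs.image h)]
    rintro _ ⟨y, hy, rfl⟩
    rw [hd]
    exact mul_le_mul_of_nonneg_left (Metric.infDist_le_dist_of_mem hy) hr.le

theorem innerNeighbourhood_image_homeomorph (h : E ≃ₜ E) {r : ℝ} (hr : 0 < r)
    (hd : ∀ x y, dist (h x) (h y) = r * dist x y) {A : Set E} (hu : A ≠ univ) (ε : ℝ) :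
    innerNeighbourhood (h '' A) ε = h '' innerNeighbourhood A (ε / r) := by
  have key : ∀ x ∈ A, Metric.infDist (h x) (frontier (h '' A)) =
      r * Metric.infDist x (frontier A) := fun x hx => by
    rw [← h.image_frontier]
    exact infDist_image_of_dist_eq hr hd x (nonempty_frontier_iff.2 ⟨⟨x, hx⟩, hu⟩)
  ext y
  constructor
  · rintro ⟨⟨x, hx, rfl⟩, hy⟩
    refine ⟨x, ⟨hx, ?_⟩, rfl⟩
    rwa [key x hx, ← le_div_iff₀' hr] at hy
  · rintro ⟨x, ⟨hx, hx'⟩, rfl⟩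
    refine ⟨mem_image_of_mem h hx, ?_⟩
    rwa [key x hx, ← le_div_iff₀' hr]

end Tube

/-! ## The geometry of the tiling -/

namespace SelfSimilarSystem

variable {d J : ℕ} (Φ : SelfSimilarSystem d J)

local notation "E" => EuclideanSpace ℝ (Fin d)

theorem isCompact_attractor : IsCompact Φ.attractor := Φ.existsUnique_attractor.choose_spec.1.2.1

theorem image_attractor : Φ.image Φ.attractor = Φ.attractor :=
  Φ.existsUnique_attractor.choose_spec.1.2.2

theorem isCompact_hull : IsCompact Φ.hull := Φ.isCompact_attractor.convexHull_of_finiteDimensional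

/-- The `j`-th similitude as a homeomorphism. -/
noncomputable def mapHomeo (j : Fin J) : E ≃ₜ E :=
  (Φ.rot j).toHomeomorph.trans ((Homeomorph.smulOfNeZero (Φ.ratio j) (Φ.ratio_pos j).ne').trans
    (Homeomorph.addRight (Φ.trans j)))

/-- The similitude `Φ_w` as a homeomorphism. -/
noncomputable def wordHomeo : List (Fin J) → E ≃ₜ E
  | [] => Homeomorph.refl _
  | j :: w => (Φ.mapHomeo j).trans (wordHomeo w)

theorem coe_wordHomeo (w : List (Fin J)) : ⇑(Φ.wordHomeo w) = Φ.wordMap w := by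
  induction w with
  | nil => rfl
  | cons j w ih =>
    funext x
    change Φ.wordHomeo w (Φ.map j x) = Φ.wordMap w (Φ.map j x)
    rw [ih]

theorem wordMap_image_nil (S : Set E) : Φ.wordMap [] '' S = S := image_id' S

theorem dist_map (j : Fin J) (x y : E) :
    dist (Φ.map j x) (Φ.map j y) = Φ.ratio j * dist x y := by
  simp only [map, dist_add_right]
  rw [dist_smul₀, LinearIsometryEquiv.dist_map, Real.norm_eq_abs, abs_of_pos (Φ.ratio_pos j)]

theorem dist_wordMap (w : List (Fin J)) (x y : E) :
    dist (Φ.wordMap w x) (Φ.wordMap w y) = Φ.wordRatio w * dist x y := by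
  induction w generalizing x y with
  | nil => simp [wordMap, wordRatio]
  | cons j w ih =>
    change dist (Φ.wordMap w (Φ.map j x)) (Φ.wordMap w (Φ.map j y)) = _
    rw [ih, dist_map, wordRatio_cons]
    ring

open scoped Pointwise in
theorem volume_map_image (j : Fin J) (S : Set E) :
    volume (Φ.map j '' S) = ENNReal.ofReal (Φ.ratio j ^ d) * volume S := by
  have h : Φ.map j '' S = (fun x => x + Φ.trans j) '' (Φ.ratio j • (Φ.rot j '' S)) := by
    rw [← image_smul, image_image, image_image]
    rfl
  rw [h, image_add_right, measure_preimage_add_right, Measure.addHaar_smul,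
    finrank_euclideanSpace_fin, abs_of_pos (pow_pos (Φ.ratio_pos j) d)]
  congr 1
  rw [LinearIsometryEquiv.image_eq_preimage_symm]
  exact (Φ.rot j).symm.measurePreserving.measure_preimage_equiv
    (f := (Φ.rot j).symm.toMeasurableEquiv) S

theorem volume_wordMap_image (w : List (Fin J)) (S : Set E) :
    volume (Φ.wordMap w '' S) = ENNReal.ofReal (Φ.wordRatio w ^ d) * volume S := by
  induction w generalizing S with
  | nil => simp [wordMap_image_nil, wordRatio]
  | cons j w ih =>
    have h : Φ.wordMap (j :: w) '' S = Φ.wordMap w '' (Φ.map j '' S) := by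
      rw [image_image]; rfl
    rw [h, ih, volume_map_image, wordRatio_cons, mul_pow, ← mul_assoc,
      ← ENNReal.ofReal_mul (pow_nonneg (Φ.wordRatio_pos w).le d), mul_comm (Φ.wordRatio w ^ d)]

theorem map_image_hull_subset (j : Fin J) : Φ.map j '' Φ.hull ⊆ Φ.hull := by
  rw [image_subset_iff]
  refine convexHull_min (fun x hx => subset_convexHull ℝ _ ?_) ?_
  · rw [← Φ.image_attractor]
    exact mem_iUnion_of_mem j (mem_image_of_mem _ hx)
  · intro x hx y hy a b ha hb hab
    have h : Φ.map j (a • x + b • y) = a • Φ.map j x + b • Φ.map j y := by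
      have ht : Φ.trans j = a • Φ.trans j + b • Φ.trans j := by rw [← add_smul, hab, one_smul]
      simp only [map, map_add, map_smul, smul_add]
      nth_rewrite 1 [ht]
      simp only [smul_comm (Φ.ratio j)]
      abel
    rw [mem_preimage, h]
    exact convex_convexHull ℝ _ hx hy ha hb hab

theorem map_image_interior_hull (j : Fin J) :
    Φ.map j '' interior Φ.hull = interior (Φ.map j '' Φ.hull) :=
  (Φ.mapHomeo j).image_interior Φ.hull

/-- The last letter is the outermost map and decides which `Φ_j(C)` contains the tile; this is why
the inductions locating tiles peel words from the right. -/
theorem wordMap_append_singleton (w : List (Fin J)) (j : Fin J) (x : E) :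
    Φ.wordMap (w ++ [j]) x = Φ.map j (Φ.wordMap w x) := by
  simp [wordMap, List.foldl_append]

theorem wordMap_image_append_singleton (w : List (Fin J)) (j : Fin J) (S : Set E) :
    Φ.wordMap (w ++ [j]) '' S = Φ.map j '' (Φ.wordMap w '' S) := by
  rw [image_image]
  simp only [wordMap_append_singleton]

theorem wordMap_image_interior_hull_subset (w : List (Fin J)) :
    Φ.wordMap w '' interior Φ.hull ⊆ interior Φ.hull := by
  induction w using List.reverseRecOn with
  | nil => rw [wordMap_image_nil]
  | append_singleton w j ih =>
    rw [wordMap_image_append_singleton]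
    refine (image_mono ih).trans ?_
    rw [map_image_interior_hull]
    exact interior_mono (Φ.map_image_hull_subset j)

/-- Distinct tiles of an open generator inside the hull are disjoint. -/
theorem disjoint_wordMap_image (hΦ : Φ.TilesetCondition) {G : Set E}
    (hG : G ⊆ interior Φ.hull \ Φ.image Φ.hull) {w v : List (Fin J)} (hwv : w ≠ v) :
    Disjoint (Φ.wordMap w '' G) (Φ.wordMap v '' G) := by
  -- A tile whose word ends in `j` lies in the interior of `Φ_j(C)`. It thus misses `G`, which
  -- avoids `Φ(C)`, and misses tiles ending in another letter; a common last letter is cancelled by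
  -- injectivity.
  have hsub : ∀ (w : List (Fin J)) (j : Fin J),
      Φ.wordMap (w ++ [j]) '' G ⊆ interior (Φ.map j '' Φ.hull) := by
    intro w j
    rw [wordMap_image_append_singleton, ← map_image_interior_hull]
    exact image_mono ((image_mono (hG.trans sdiff_subset)).trans
      (Φ.wordMap_image_interior_hull_subset w))
  have hnil : ∀ (w : List (Fin J)) (j : Fin J),
      Disjoint (Φ.wordMap [] '' G) (Φ.wordMap (w ++ [j]) '' G) := by
    intro w j
    rw [wordMap_image_nil]
    exact disjoint_of_subset hG ((hsub w j).trans (interior_subset.trans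
      (subset_iUnion (fun j => Φ.map j '' Φ.hull) j))) disjoint_sdiff_left
  induction w using List.reverseRecOn generalizing v with
  | nil =>
    induction v using List.reverseRecOn with
    | nil => exact absurd rfl hwv
    | append_singleton v j _ => exact hnil v j
  | append_singleton w i ih =>
    induction v using List.reverseRecOn with
    | nil => exact (hnil w i).symm
    | append_singleton v j _ =>
      by_cases hij : i = j
      · subst hij
        rw [wordMap_image_append_singleton, wordMap_image_append_singleton]
        exact (disjoint_image_iff (Φ.mapHomeo i).injective).2 <| ih fun h => hwv (by rw [h])
      · exact disjoint_of_subset (hsub w i) (hsub v j)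
          (disjoint_iff_inter_eq_empty.2 (hΦ.2 i j hij))

/-! ### Topology and volume of a generator with positive inradius -/

section Generator

variable {Φ} {G : Set (EuclideanSpace ℝ (Fin d))}

theorem generator_subset (hG : G ∈ Φ.generators) : G ⊆ Φ.hullInterior \ Φ.image Φ.hull := by
  obtain ⟨x, -, rfl⟩ := hG
  exact connectedComponentIn_subset _ _

theorem hullInterior_eq_interior (hG : G ∈ Φ.generators) (hg : 0 < inradius G) :
    Φ.hullInterior = interior Φ.hull := by
  obtain ⟨x, ε, hε, hball⟩ := exists_ball_subset_of_inradius_pos hg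
  refine intrinsicInterior_eq_interior ⟨x, mem_interior.2 ⟨_, ?_, Metric.isOpen_ball,
    Metric.mem_ball_self hε⟩⟩
  exact hball.trans ((generator_subset hG).trans (sdiff_subset.trans intrinsicInterior_subset))

theorem isClosed_image_hull : IsClosed (Φ.image Φ.hull) :=
  (isCompact_iUnion fun j => Φ.isCompact_hull.image (Φ.mapHomeo j).continuous).isClosed

theorem isOpen_generator (hG : G ∈ Φ.generators) (hg : 0 < inradius G) : IsOpen G := by
  have h := hullInterior_eq_interior hG hg
  obtain ⟨x, -, rfl⟩ := hG
  rw [h]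
  exact (isOpen_interior.sdiff isClosed_image_hull).connectedComponentIn

theorem volume_interior_hull_ne_top : volume (interior Φ.hull) ≠ ∞ :=
  measure_ne_top_of_subset interior_subset Φ.isCompact_hull.measure_lt_top.ne

theorem interior_hull_ne_univ (hG : G ∈ Φ.generators) (hg : 0 < inradius G) :
    interior Φ.hull ≠ univ := by
  intro hu
  -- In dimension `0` every ball is the whole one-point space, the radii are unbounded and the
  -- inradius is the default `0`. In positive dimension the space is not compact, unlike the hull.
  have hd : 0 < d := by
    by_contra hd
    obtain rfl : d = 0 := by omega
    obtain ⟨M, hM⟩ := bddAbove_radii_of_inradius_pos hg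
    obtain ⟨y, ε, hε, hball⟩ := exists_ball_subset_of_inradius_pos hg
    have hy : Metric.ball y (|M| + 1) ⊆ G := fun z _ =>
      Subsingleton.elim y z ▸ hball (Metric.mem_ball_self hε)
    have : |M| + 1 ≤ M := hM ⟨by positivity, y, hy⟩
    linarith [le_abs_self M]
  have : Nonempty (Fin d) := ⟨⟨0, hd⟩⟩
  have hc := Φ.isCompact_hull
  rw [univ_subset_iff.1 (hu ▸ interior_subset : univ ⊆ Φ.hull)] at hc
  exact noncompact_univ E hc

theorem tilingSet_eq (hG : Φ.generators = {G}) : Φ.tilingSet = ⋃ w, Φ.wordMap w '' G := by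
  ext x
  simp [tilingSet, tiling, hG]

/-- The inner neighbourhood of the union splits into those of the disjoint open tiles, and the
similitude `Φ_w` scales lengths by `r_w` and volumes by `r_w ^ d`. -/
theorem hasSum_innerTubeVolume (hΦ : Φ.TilesetCondition) (hG : Φ.generators = {G})
    (hg : 0 < inradius G) (ε : ℝ) :
    HasSum (fun w => Φ.wordRatio w ^ d * innerTubeVolume G (ε / Φ.wordRatio w))
      (innerTubeVolume Φ.tilingSet ε) := by
  have hmem : G ∈ Φ.generators := hG ▸ rfl
  have hGsub : G ⊆ interior Φ.hull \ Φ.image Φ.hull :=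
    hullInterior_eq_interior hmem hg ▸ generator_subset hmem
  have hGo := isOpen_generator hmem hg
  have hint : ∀ w, Φ.wordMap w '' G ⊆ interior Φ.hull := fun w =>
    (image_mono (hGsub.trans sdiff_subset)).trans (Φ.wordMap_image_interior_hull_subset w)
  have hproper : ∀ A ⊆ interior Φ.hull, A ≠ univ := fun A hA h =>
    interior_hull_ne_univ hmem hg (univ_subset_iff.1 (h ▸ hA))
  have hopen : ∀ w, IsOpen (Φ.wordMap w '' G) := fun w => by
    rw [← coe_wordHomeo]
    exact (Φ.wordHomeo w).isOpenMap _ hGo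
  have hdisj : Pairwise (Function.onFun Disjoint fun w => Φ.wordMap w '' G) := fun w v h =>
    Φ.disjoint_wordMap_image hΦ hGsub h
  have htile : ∀ w, innerNeighbourhood (Φ.wordMap w '' G) ε =
      Φ.wordMap w '' innerNeighbourhood G (ε / Φ.wordRatio w) := fun w => by
    simp only [← coe_wordHomeo]
    exact innerNeighbourhood_image_homeomorph _ (Φ.wordRatio_pos w)
      (fun x y => by rw [coe_wordHomeo, dist_wordMap]) (hproper G (hGsub.trans sdiff_subset)) ε
  have hU : innerNeighbourhood Φ.tilingSet ε = ⋃ w, innerNeighbourhood (Φ.wordMap w '' G) ε := by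
    rw [tilingSet_eq hG]
    exact innerNeighbourhood_iUnion hopen hdisj (hproper _ (iUnion_subset hint)) ε
  have hvol : volume (innerNeighbourhood Φ.tilingSet ε) =
      ∑' w, volume (innerNeighbourhood (Φ.wordMap w '' G) ε) := by
    rw [hU]
    exact measure_iUnion (fun w v h => (hdisj h).mono (innerNeighbourhood_subset _ _)
      (innerNeighbourhood_subset _ _)) fun w => measurableSet_innerNeighbourhood (hopen w) ε
  have hfin : volume (innerNeighbourhood Φ.tilingSet ε) ≠ ∞ := by
    refine measure_ne_top_of_subset ?_ (volume_interior_hull_ne_top (Φ := Φ))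
    rw [hU]
    exact iUnion_subset fun w => (innerNeighbourhood_subset _ _).trans (hint w)
  have h := ENNReal.hasSum_toReal (hvol ▸ hfin)
  rw [← ENNReal.tsum_toReal_eq (ENNReal.ne_top_of_tsum_ne_top (hvol ▸ hfin)), ← hvol] at h
  convert! h using 2 with w
  rw [htile, volume_wordMap_image, ENNReal.toReal_mul,
    ENNReal.toReal_ofReal (pow_nonneg (Φ.wordRatio_pos w).le d)]
  rfl

theorem volume_tilingSet_ne_top (hG : Φ.generators = {G}) (hg : 0 < inradius G) :
    volume Φ.tilingSet ≠ ∞ := by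
  have hmem : G ∈ Φ.generators := hG ▸ rfl
  refine measure_ne_top_of_subset ?_ (volume_interior_hull_ne_top (Φ := Φ))
  rw [tilingSet_eq hG]
  exact iUnion_subset fun w => (image_mono ((hullInterior_eq_interior hmem hg ▸
    generator_subset hmem).trans sdiff_subset)).trans (Φ.wordMap_image_interior_hull_subset w)

theorem volume_generator_ne_top (hG : G ∈ Φ.generators) : volume G ≠ ∞ :=
  measure_ne_top_of_subset ((generator_subset hG).trans
    (sdiff_subset.trans intrinsicInterior_subset)) Φ.isCompact_hull.measure_lt_top.ne

/-- The disjoint sets `Φ_j(int C)` and `G` all fit into `int C`. Since `G` is open and nonempty it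
takes positive volume, which makes the inequality strict. -/
theorem sum_ratio_pow_lt_one (hΦ : Φ.TilesetCondition) (hG : G ∈ Φ.generators)
    (hg : 0 < inradius G) : ∑ j, Φ.ratio j ^ d < 1 := by
  have hGsub : G ⊆ interior Φ.hull \ Φ.image Φ.hull :=
    hullInterior_eq_interior hG hg ▸ generator_subset hG
  have hGo := isOpen_generator hG hg
  obtain ⟨x, ε, hε, hball⟩ := exists_ball_subset_of_inradius_pos hg
  have hGpos : 0 < volume.real G :=
    ENNReal.toReal_pos (hGo.measure_pos volume ⟨x, hball (Metric.mem_ball_self hε)⟩).ne'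
      (volume_generator_ne_top hG)
  set U := interior Φ.hull with hU
  have hUtop : volume U ≠ ∞ := volume_interior_hull_ne_top
  have hmeas : ∀ j, MeasurableSet (Φ.map j '' U) := fun j =>
    ((Φ.mapHomeo j).isOpenMap _ isOpen_interior).measurableSet
  have hsub : ∀ j, Φ.map j '' U ⊆ U := fun j => by
    rw [hU, map_image_interior_hull]
    exact interior_mono (Φ.map_image_hull_subset j)
  have hjtop : ∀ j, volume (Φ.map j '' U) ≠ ∞ := fun j => measure_ne_top_of_subset (hsub j) hUtop
  have h1 : volume.real (⋃ j, Φ.map j '' U) = (∑ j, Φ.ratio j ^ d) * volume.real U := by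
    rw [measureReal_iUnion_fintype (fun i j hij => ?_) hmeas hjtop, Finset.sum_mul]
    · refine Finset.sum_congr rfl fun j _ => ?_
      rw [Measure.real, volume_map_image, ENNReal.toReal_mul,
        ENNReal.toReal_ofReal (pow_nonneg (Φ.ratio_pos j).le d)]
      rfl
    · rw [Function.onFun, hU, map_image_interior_hull, map_image_interior_hull]
      exact disjoint_iff_inter_eq_empty.2 (hΦ.2 i j hij)
  have h2 : volume.real G + volume.real (⋃ j, Φ.map j '' U) ≤ volume.real U := by
    rw [← measureReal_union _ (MeasurableSet.iUnion hmeas) (volume_generator_ne_top hG)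
      (measure_ne_top_of_subset (iUnion_subset hsub) hUtop)]
    · exact measureReal_mono (union_subset (hGsub.trans sdiff_subset) (iUnion_subset hsub)) hUtop
    · exact disjoint_of_subset hGsub (iUnion_mono fun j => image_mono interior_subset)
        disjoint_sdiff_left
  by_contra! h
  have h3 : volume.real U ≤ (∑ j, Φ.ratio j ^ d) * volume.real U :=
    le_mul_of_one_le_left measureReal_nonneg h
  linarith

end Generator

end SelfSimilarSystem

/-! ## Mellin transforms of tube volumes -/

section MellinTube

/-- The Mellin transform `∑_{k ≤ d} g^{s-k} / (s-k) κ_k` of a monophase tube volume. -/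
noncomputable def polarSum (g : ℝ) (κ : ℕ → ℝ) (d : ℕ) (s : ℂ) : ℂ :=
  ∑ k ∈ Finset.range (d + 1), (g : ℂ) ^ (s - (k : ℂ)) / (s - (k : ℂ)) * (κ k : ℂ)

/-- On `(0, g)` the monomials integrate to the terms `k < d`, convergent for `Re s > d - 1`; on `(g,
∞)` the constant `-κ d` gives the term `k = d`, convergent for `Re s < d`. -/
theorem hasMellin_monophase {d : ℕ} {g : ℝ} (hg : 0 < g) {κ : ℕ → ℝ} {v : ℝ → ℝ}
    (h1 : ∀ x, 0 < x → x < g → v x = ∑ k ∈ Finset.range d, κ k * x ^ (d - k))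
    (h2 : ∀ x, g ≤ x → v x = -κ d) {s : ℂ} (hs1 : (d : ℝ) - 1 < s.re) (hs2 : s.re < d) :
    HasMellin (fun x => (v x : ℂ)) (s - d) (polarSum g κ d s) := by
  have hre : ∀ k ∈ Finset.range d, -1 < (s - k - 1).re := fun k hk => by
    have : (k : ℝ) + 1 ≤ d := by exact_mod_cast Finset.mem_range.1 hk
    simp
    linarith
  set F : ℝ → ℂ := fun x => ∑ k ∈ Finset.range d, (κ k : ℂ) * (x : ℂ) ^ (s - k - 1) with hF
  have hterm : ∀ k ∈ Finset.range d,
      IntervalIntegrable (fun x : ℝ => (κ k : ℂ) * (x : ℂ) ^ (s - k - 1)) volume 0 g := fun k hk =>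
    (intervalIntegral.intervalIntegrable_cpow' (hre k hk)).const_mul _
  have hFi : IntervalIntegrable F volume 0 g := by
    have h := IntervalIntegrable.sum (Finset.range d) hterm
    rwa [show ∑ k ∈ Finset.range d, (fun x : ℝ => (κ k : ℂ) * (x : ℂ) ^ (s - k - 1)) = F by
      funext x; simp [hF]] at h
  have hFon : IntegrableOn F (Ioc 0 g) :=
    (intervalIntegrable_iff_integrableOn_Ioc_of_le hg.le).1 hFi
  have hFint : ∫ x in Ioc 0 g, F x =
      ∑ k ∈ Finset.range d, (g : ℂ) ^ (s - (k : ℂ)) / (s - (k : ℂ)) * (κ k : ℂ) := by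
    rw [← intervalIntegral.integral_of_le hg.le, intervalIntegral.integral_finsetSum hterm]
    refine Finset.sum_congr rfl fun k hk => ?_
    have hne : s - k ≠ 0 := fun h => by
      have := hre k hk
      rw [h] at this
      simp at this
    rw [intervalIntegral.integral_const_mul, integral_cpow (Or.inl (hre k hk)), sub_add_cancel,
      Complex.ofReal_zero, Complex.zero_cpow hne, sub_zero, mul_comm]
  have hIoo : EqOn (fun x : ℝ => (x : ℂ) ^ (s - d - 1) • (v x : ℂ)) F (Ioo 0 g) := by
    intro x hx
    have hx0 : (x : ℂ) ≠ 0 := by exact_mod_cast hx.1.ne'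
    simp only [hF, h1 x hx.1 hx.2, smul_eq_mul]
    push_cast
    rw [Finset.mul_sum]
    refine Finset.sum_congr rfl fun k hk => ?_
    rw [← Complex.cpow_natCast, mul_left_comm, ← Complex.cpow_add _ _ hx0,
      Nat.cast_sub (Finset.mem_range.1 hk).le]
    congr 2
    ring
  have hIoi : EqOn (fun x : ℝ => (x : ℂ) ^ (s - d - 1) • (v x : ℂ))
      (fun x => (x : ℂ) ^ (s - d - 1) * (-κ d : ℂ)) (Ioi g) := by
    intro x hx
    simp [h2 x (le_of_lt hx)]
  have hlt : (s - d - 1).re < -1 := by simp; linarith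
  have i1 : IntegrableOn (fun x : ℝ => (x : ℂ) ^ (s - d - 1) • (v x : ℂ)) (Ioc 0 g) := by
    rw [integrableOn_Ioc_iff_integrableOn_Ioo]
    exact (hFon.mono_set Ioo_subset_Ioc_self).congr_fun hIoo.symm measurableSet_Ioo
  have i2 : IntegrableOn (fun x : ℝ => (x : ℂ) ^ (s - d - 1) • (v x : ℂ)) (Ioi g) :=
    IntegrableOn.congr_fun (Integrable.mul_const (integrableOn_Ioi_cpow_of_lt hlt hg) _) hIoi.symm
      measurableSet_Ioi
  have hU : Ioi (0 : ℝ) = Ioc 0 g ∪ Ioi g := (Ioc_union_Ioi_eq_Ioi hg.le).symm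
  refine ⟨?_, ?_⟩
  · rw [MellinConvergent, hU]
    exact i1.union i2
  · rw [mellin, hU, setIntegral_union (Ioc_disjoint_Ioi le_rfl) measurableSet_Ioi i1 i2,
      integral_Ioc_eq_integral_Ioo, setIntegral_congr_fun measurableSet_Ioo hIoo,
      ← integral_Ioc_eq_integral_Ioo, hFint, setIntegral_congr_fun measurableSet_Ioi hIoi,
      integral_mul_const, integral_Ioi_cpow_of_lt hlt hg, polarSum, Finset.sum_range_succ,
      sub_add_cancel]
    ring

/-- The Mellin transform of a sum of rescaled copies of a function. -/
theorem hasMellin_sum_rescaled {ι : Type*} [Countable ι] {d : ℕ} {v W : ℝ → ℝ} {ρ : ι → ℝ}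
    (hρ : ∀ i, 0 < ρ i) (hW : Measurable W)
    (hsum : ∀ x, 0 < x → HasSum (fun i => ρ i ^ d * v (x / ρ i)) (W x)) {z : ℂ}
    (hv : MellinConvergent (fun x => (v x : ℂ)) z) (hS : Summable fun i => ρ i ^ (z.re + d)) :
    MellinConvergent (fun x => (W x : ℂ)) z ∧
      HasSum (fun i => (ρ i : ℂ) ^ (z + d) * mellin (fun x => (v x : ℂ)) z)
        (mellin (fun x => (W x : ℂ)) z) := by
  set f : ι → ℝ → ℂ := fun i x => (x : ℂ) ^ (z - 1) • ((ρ i : ℂ) ^ d * (v ((ρ i)⁻¹ * x) : ℂ))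
  have hsumC : ∀ x ∈ Ioi (0 : ℝ), HasSum (fun i => f i x) ((x : ℂ) ^ (z - 1) • (W x : ℂ)) := by
    intro x hx
    have h := (hsum x hx).mapL Complex.ofRealCLM
    refine HasSum.const_smul _ ?_
    convert! h using 2 with i
    simp [div_eq_inv_mul]
  have hconv : ∀ i, MellinConvergent (fun x => (v ((ρ i)⁻¹ * x) : ℂ)) z := fun i =>
    (MellinConvergent.comp_mul_left (f := fun x => (v x : ℂ)) (inv_pos.2 (hρ i))).2 hv
  have hfi : ∀ i, IntegrableOn (f i) (Ioi 0) := fun i => by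
    have := (hconv i).const_smul ((ρ i : ℂ) ^ d)
    simpa only [smul_eq_mul, MellinConvergent, f] using this
  have hint : ∀ i, ∫ x in Ioi 0, f i x =
      (ρ i : ℂ) ^ (z + d) * mellin (fun x => (v x : ℂ)) z := by
    intro i
    have h0 : (ρ i : ℂ) ≠ 0 := by exact_mod_cast (hρ i).ne'
    change mellin (fun x => (ρ i : ℂ) ^ d • (v ((ρ i)⁻¹ * x) : ℂ)) z = _
    rw [mellin_const_smul, mellin_comp_mul_left (fun x => (v x : ℂ)) z (inv_pos.2 (hρ i)),
      smul_eq_mul, smul_eq_mul, Complex.cpow_add _ _ h0, Complex.cpow_natCast,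
      Complex.cpow_neg, Complex.ofReal_inv, Complex.inv_cpow, inv_inv]
    · ring
    · rw [Complex.arg_ofReal_of_nonneg (hρ i).le]
      exact Real.pi_pos.ne
  set K := ∫ x in Ioi (0 : ℝ), ‖(x : ℂ) ^ (z - 1) • (v x : ℂ)‖
  -- The exact scaling of the `L¹` norms turns `hS` into the summability that permits termwise
  -- integration.
  have hnorm : ∀ i, ∫ x in Ioi 0, ‖f i x‖ = ρ i ^ (z.re + d) * K := by
    intro i
    have hr := hρ i
    have h1 : ∀ x ∈ Ioi (0 : ℝ), ‖f i x‖ = ρ i ^ (z.re + d - 1) *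
        (fun u : ℝ => ‖(u : ℂ) ^ (z - 1) • (v u : ℂ)‖) ((ρ i)⁻¹ * x) := by
      intro x hx
      have hx' : 0 < x := hx
      simp only [f, norm_smul, norm_mul, norm_pow]
      rw [Complex.norm_cpow_eq_rpow_re_of_pos hx',
        Complex.norm_cpow_eq_rpow_re_of_pos (mul_pos (inv_pos.2 hr) hx'),
        Real.mul_rpow (inv_pos.2 hr).le hx'.le, Real.inv_rpow hr.le, Complex.norm_real (ρ i),
        Real.norm_of_nonneg hr.le,
        show z.re + d - 1 = (z - 1).re + d by simp; ring, Real.rpow_add hr, Real.rpow_natCast]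
      have := (Real.rpow_pos_of_pos hr (z - 1).re).ne'
      field_simp
    rw [setIntegral_congr_fun measurableSet_Ioi h1, integral_const_mul,
      integral_comp_mul_left_Ioi (fun u : ℝ => ‖(u : ℂ) ^ (z - 1) • (v u : ℂ)‖) _
        (inv_pos.2 hr), mul_zero, inv_inv, smul_eq_mul, ← mul_assoc]
    congr 1
    nth_rewrite 2 [← Real.rpow_one (ρ i)]
    rw [← Real.rpow_add hr, sub_add_cancel]
  have hsn : Summable fun i => ∫ x in Ioi 0, ‖f i x‖ := by
    simp only [hnorm]
    exact hS.mul_right K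
  have hmain := hasSum_integral_of_summable_integral_norm hfi hsn
  rw [setIntegral_congr_fun measurableSet_Ioi fun x hx => (hsumC x hx).tsum_eq] at hmain
  simp only [hint] at hmain
  refine ⟨⟨?_, ?_⟩, hmain⟩
  · refine Measurable.aestronglyMeasurable ?_
    exact (Complex.measurable_ofReal.pow_const _).smul (Complex.measurable_ofReal.comp hW)
  · have hle : ∫⁻ x in Ioi (0 : ℝ), ‖(x : ℂ) ^ (z - 1) • (W x : ℂ)‖ₑ ≤
        ∑' i, ENNReal.ofReal (∫ x in Ioi 0, ‖f i x‖) := by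
      calc ∫⁻ x in Ioi (0 : ℝ), ‖(x : ℂ) ^ (z - 1) • (W x : ℂ)‖ₑ
          ≤ ∫⁻ x in Ioi (0 : ℝ), ∑' i, ‖f i x‖ₑ := by
            refine setLIntegral_mono' measurableSet_Ioi fun x hx => ?_
            rw [← (hsumC x hx).tsum_eq]
            exact enorm_tsum_le_tsum_enorm
        _ = ∑' i, ∫⁻ x in Ioi (0 : ℝ), ‖f i x‖ₑ := lintegral_tsum fun i => (hfi i).1.enorm
        _ = _ := by
            congr 1
            funext i
            rw [ofReal_integral_norm_eq_lintegral_enorm (hfi i)]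
    exact hle.trans_lt hsn.tsum_ofReal_lt_top

/-- Parseval's formula for the Mellin transform, against a test function. -/
theorem integral_mul_test_eq {φ : ℝ → ℂ} {a b : ℝ} (hφ : ContDiff ℝ (⊤ : ℕ∞) φ) (ha : 0 < a)
    (hab : a ≤ b) (hs : tsupport φ ⊆ Icc a b) {W : ℝ → ℂ} (p : ℝ)
    (hW : MellinConvergent W (1 - p)) :
    ∫ x in Ioi (0 : ℝ), W x * φ x = (1 / (2 * Real.pi) : ℝ) •
      ∫ y : ℝ, mellin W (1 - (p + y * Complex.I)) * mellin φ (p + y * Complex.I) := by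
  have hvert := verticalIntegrable_mellin_test hφ ha hab hs p
  have hW' : IntegrableOn (fun x : ℝ => (x : ℂ) ^ (-(p : ℂ)) * W x) (Ioi 0) := by
    have : (1 - p : ℂ) - 1 = -p := by ring
    simpa only [MellinConvergent, this, smul_eq_mul] using hW
  have hprod := Integrable.mul_prod hW' hvert
  -- The integrand obtained from Mellin inversion of `φ` is a product function times the unimodular
  -- factor `x ^ (-iy)`, so Fubini applies.
  have hprod2 : Integrable (fun q : ℝ × ℝ => (q.1 : ℂ) ^ (-(q.2 * Complex.I)) *
      ((q.1 : ℂ) ^ (-(p : ℂ)) * W q.1 * mellin φ (p + q.2 * Complex.I)))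
      ((volume.restrict (Ioi 0)).prod volume) := by
    refine hprod.mono ?_ ?_
    · refine AEStronglyMeasurable.mul (Measurable.aestronglyMeasurable ?_) hprod.1
      exact (Complex.measurable_ofReal.comp measurable_fst).pow
        (((Complex.measurable_ofReal.comp measurable_snd).mul_const _).neg)
    · have hae : ∀ᵐ q : ℝ × ℝ ∂((volume.restrict (Ioi 0)).prod volume), q.1 ∈ Ioi (0 : ℝ) :=
        Measure.quasiMeasurePreserving_fst.ae (ae_restrict_mem measurableSet_Ioi)
      filter_upwards [hae] with q hq
      rw [norm_mul, Complex.norm_cpow_eq_rpow_re_of_pos hq]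
      simp
  have hswap := integral_integral_swap (f := fun x y : ℝ => (x : ℂ) ^ (-(y * Complex.I)) *
      ((x : ℂ) ^ (-(p : ℂ)) * W x * mellin φ (p + y * Complex.I))) hprod2
  have hcpow : ∀ x ∈ Ioi (0 : ℝ), ∀ y : ℝ, (x : ℂ) ^ (-((p : ℂ) + y * Complex.I)) =
      (x : ℂ) ^ (-(y * Complex.I)) * (x : ℂ) ^ (-(p : ℂ)) := by
    intro x hx y
    rw [neg_add_rev, Complex.cpow_add _ _ (by exact_mod_cast (ne_of_gt hx))]
  calc ∫ x in Ioi (0 : ℝ), W x * φ x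
      = ∫ x in Ioi (0 : ℝ), (1 / (2 * Real.pi) : ℝ) • ∫ y : ℝ, (x : ℂ) ^ (-(y * Complex.I)) *
          ((x : ℂ) ^ (-(p : ℂ)) * W x * mellin φ (p + y * Complex.I)) := by
        refine setIntegral_congr_fun measurableSet_Ioi fun x hx => ?_
        rw [mellin_inversion_test hφ ha hab hs p hx, mul_smul_comm, ← integral_const_mul]
        congr 2
        funext y
        rw [hcpow x hx]
        ring
    _ = _ := by
        rw [integral_smul, hswap]
        congr 2
        funext y
        rw [mellin.eq_1 W, ← integral_mul_const]
        refine setIntegral_congr_fun measurableSet_Ioi fun x hx => ?_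
        have : (1 - ((p : ℂ) + y * Complex.I)) - 1 = -(p + y * Complex.I) := by ring
        simp only [this, hcpow x hx, smul_eq_mul]
        ring

end MellinTube

/-! ### The tube volume as a line integral of the tubular zeta function -/

namespace SelfSimilarSystem

variable {d J : ℕ} {Φ : SelfSimilarSystem d J} {G : Set (EuclideanSpace ℝ (Fin d))} {κ : ℕ → ℝ}

theorem tubularZetaAction_eq (φ : ℝ → ℂ) (s : ℂ) :
    Φ.tubularZetaAction G κ φ s =
      (moran Φ.ratio s)⁻¹ * polarSum (inradius G) κ d s * mellin φ (d + 1 - s) := by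
  have h : (d : ℂ) + 1 - s - 1 = d - s := by ring
  rw [mellin, ← integral_const_mul, tubularZetaAction]
  congr 1
  funext ε
  rw [tubularZeta, scalingZeta_eq, Pi.inv_apply, h, smul_eq_mul, polarSum]
  ring

theorem hasMellin_tilingSet (hΦ : Φ.TilesetCondition) (hG : Φ.generators = {G})
    (hg : 0 < inradius G) (hκ : IsMonophase G κ) {s : ℂ} (hs1 : (d : ℝ) - 1 < s.re)
    (hs2 : s.re < d) (hs : ∑ j, Φ.ratio j ^ s.re < 1) :
    HasMellin (fun x => (innerTubeVolume Φ.tilingSet x : ℂ)) (s - d)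
      ((moran Φ.ratio s)⁻¹ * polarSum (inradius G) κ d s) := by
  have hmem : G ∈ Φ.generators := hG ▸ rfl
  have hv := hasMellin_monophase hg hκ.1 (fun x hx => by
    rw [innerTubeVolume_of_inradius_le (isOpen_generator hmem hg) hg hx, hκ.2, neg_neg]) hs1 hs2
  have hre : (s - d).re + d = s.re := by simp
  have h := hasMellin_sum_rescaled Φ.wordRatio_pos
    (monotone_innerTubeVolume (volume_tilingSet_ne_top hG hg)).measurable
    (fun x _ => hasSum_innerTubeVolume hΦ hG hg x) hv.1
    (by rw [hre]; exact Φ.summable_wordRatio_rpow hs)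
  refine ⟨h.1, h.2.unique ?_⟩
  rw [hv.2, sub_add_cancel]
  exact (Φ.hasSum_wordRatio_cpow hs).mul_right _

theorem integral_innerTubeVolume_mul_test (hΦ : Φ.TilesetCondition) (hG : Φ.generators = {G})
    (hg : 0 < inradius G) (hκ : IsMonophase G κ) {c : ℝ} (hc1 : (d : ℝ) - 1 < c)
    (hc2 : c < d) (hc : ∑ j, Φ.ratio j ^ c < 1) {φ : ℝ → ℂ} {a b : ℝ}
    (hφ : ContDiff ℝ (⊤ : ℕ∞) φ) (ha : 0 < a) (hab : a ≤ b) (hs : tsupport φ ⊆ Icc a b) :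
    ∫ x in Ioi (0 : ℝ), (innerTubeVolume Φ.tilingSet x : ℂ) * φ x =
      (1 / (2 * Real.pi) : ℝ) • ∫ y : ℝ, Φ.tubularZetaAction G κ φ (c + y * Complex.I) := by
  have hM : ∀ y : ℝ, HasMellin (fun x => (innerTubeVolume Φ.tilingSet x : ℂ))
      (((c : ℂ) + y * Complex.I) - d) _ := fun y =>
    hasMellin_tilingSet hΦ hG hg hκ (by simpa using hc1) (by simpa using hc2) (by simpa using hc)
  -- With abscissa `p = d + 1 - c` one has `1 - (p + iy) = (c - iy) - d`; the reflection `y ↦ -y`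
  -- restores the upward orientation of the line `Re s = c`.
  rw [integral_mul_test_eq hφ ha hab hs (d + 1 - c) ?_,
    ← integral_neg_eq_self (fun y : ℝ => Φ.tubularZetaAction G κ φ (c + y * Complex.I))]
  · congr 2
    funext y
    have e1 : (1 : ℂ) - (((d + 1 - c : ℝ) : ℂ) + y * Complex.I) =
        (c : ℂ) + ((-y : ℝ) : ℂ) * Complex.I - d := by push_cast; ring
    have e2 : ((d + 1 - c : ℝ) : ℂ) + y * Complex.I =
        (d : ℂ) + 1 - (c + ((-y : ℝ) : ℂ) * Complex.I) := by push_cast; ring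
    rw [e1, (hM (-y)).2, e2, tubularZetaAction_eq]
  · have := (hM 0).1
    convert this using 1
    push_cast
    ring

end SelfSimilarSystem

/-! ## Estimates on the contour and the tube formula -/

theorem one_sub_sum_le_norm_moran {ι : Type*} [Fintype ι] {r : ι → ℝ} (h0 : ∀ i, 0 < r i) (s : ℂ) :
    1 - ∑ i, r i ^ s.re ≤ ‖moran r s‖ := by
  have h1 : ‖∑ i, (r i : ℂ) ^ s‖ ≤ ∑ i, r i ^ s.re :=
    (norm_sum_le _ _).trans_eq (Finset.sum_congr rfl fun i _ =>
      Complex.norm_cpow_eq_rpow_re_of_pos (h0 i) s)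
  have h2 := norm_sub_norm_le (1 : ℂ) (∑ i, (r i : ℂ) ^ s)
  rw [norm_one] at h2
  exact (sub_le_sub_left h1 1).trans h2

section PolarSum

variable {g : ℝ} {κ : ℕ → ℝ} {d : ℕ}

theorem differentiableAt_polarSum (hg : 0 < g) {s : ℂ} (hs : ∀ k ≤ d, s ≠ k) :
    DifferentiableAt ℂ (polarSum g κ d) s := by
  refine DifferentiableAt.fun_sum fun k hk => DifferentiableAt.mul_const ?_ _
  have hd : DifferentiableAt ℂ (fun s : ℂ => s - k) s := differentiableAt_id.sub_const _
  refine (hd.const_cpow (Or.inl (by exact_mod_cast hg.ne'))).div hd (sub_ne_zero.2 (hs k ?_))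
  exact Finset.mem_range_succ_iff.1 hk

theorem meromorphicAt_polarSum (hg : 0 < g) (s : ℂ) : MeromorphicAt (polarSum g κ d) s := by
  refine MeromorphicAt.fun_sum fun k _ => ?_
  have hd : Differentiable ℂ (fun s : ℂ => s - k) := differentiable_id.sub_const _
  have hc : Differentiable ℂ (fun s : ℂ => (g : ℂ) ^ (s - k)) := fun s =>
    (hd s).const_cpow (Or.inl (by exact_mod_cast hg.ne'))
  exact ((hc.analyticAt s).meromorphicAt.div (hd.analyticAt s).meromorphicAt).mul
    (MeromorphicAt.const _ _)

theorem norm_polarSum_le (hg : 0 < g) {η : ℝ} (hη : 0 < η) {s : ℂ} (hs : ∀ k ≤ d, η ≤ ‖s - k‖) :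
    ‖polarSum g κ d s‖ ≤ (∑ k ∈ Finset.range (d + 1), g ^ (-(k : ℝ)) / η * |κ k|) * g ^ s.re := by
  rw [polarSum, Finset.sum_mul]
  refine norm_sum_le_of_le _ fun k hk => ?_
  rw [norm_mul, norm_div, Complex.norm_cpow_eq_rpow_re_of_pos hg, Complex.norm_real,
    Real.norm_eq_abs]
  have e : g ^ (s - k).re = g ^ (-(k : ℝ)) * g ^ s.re := by
    rw [← Real.rpow_add hg]; congr 1; simp; ring
  calc g ^ (s - k).re / ‖s - k‖ * |κ k| ≤ g ^ (s - k).re / η * |κ k| := by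
        gcongr
        exact hs k (Finset.mem_range_succ_iff.1 hk)
    _ = _ := by rw [e]; ring

end PolarSum

namespace SelfSimilarSystem

variable {d J : ℕ} {Φ : SelfSimilarSystem d J} {G : Set (EuclideanSpace ℝ (Fin d))} {κ : ℕ → ℝ}
  {φ : ℝ → ℂ} {a b : ℝ}

theorem ratio_iInf_pos (Φ : SelfSimilarSystem d J) : 0 < ⨅ j, Φ.ratio j := by
  have := Φ.nonempty_fin
  obtain ⟨i, hi⟩ := exists_eq_ciInf_of_finite (f := Φ.ratio)
  exact hi ▸ Φ.ratio_pos i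

theorem differentiableAt_tubularZetaAction (hg : 0 < inradius G) (hφ : Continuous φ) (ha : 0 < a)
    (hs : tsupport φ ⊆ Icc a b) {s : ℂ} (h1 : moran Φ.ratio s ≠ 0) (h2 : ∀ k ≤ d, s ≠ k) :
    DifferentiableAt ℂ (Φ.tubularZetaAction G κ φ) s := by
  rw [funext (tubularZetaAction_eq (Φ := Φ) (G := G) (κ := κ) φ)]
  have hm : DifferentiableAt ℂ (fun s : ℂ => mellin φ (d + 1 - s)) s :=
    ((differentiable_mellin_test hφ ha hs).comp
      ((differentiable_const ((d : ℂ) + 1)).sub differentiable_id)) s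
  exact (((differentiable_moran Φ.ratio_pos s).fun_inv h1).mul
    (differentiableAt_polarSum hg h2)).mul hm

theorem meromorphicAt_tubularZetaAction (hg : 0 < inradius G) (hφ : Continuous φ) (ha : 0 < a)
    (hs : tsupport φ ⊆ Icc a b) (s : ℂ) :
    MeromorphicAt (Φ.tubularZetaAction G κ φ) s := by
  rw [funext (tubularZetaAction_eq (Φ := Φ) (G := G) (κ := κ) φ)]
  have hm : Differentiable ℂ (fun s : ℂ => mellin φ (d + 1 - s)) :=
    (differentiable_mellin_test hφ ha hs).comp
      ((differentiable_const ((d : ℂ) + 1)).sub differentiable_id)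
  exact ((((differentiable_moran Φ.ratio_pos).analyticAt s).meromorphicAt.inv.mul
    (meromorphicAt_polarSum hg s)).mul (hm.analyticAt s).meromorphicAt)

/-- The three factors of the action contribute `ρ^{-Re s}` (scaling zeta), `g^{Re s}` (polar sum,
away from its poles) and `b^{-Re s} / (1 + (Im s)^2)` (test function). -/
theorem exists_tubularZetaAction_bound (hg : 0 < inradius G) (hφ : ContDiff ℝ (⊤ : ℕ∞) φ)
    (ha : 0 < a) (hab : a ≤ b) (hs : tsupport φ ⊆ Icc a b) (c : ℝ) {K η : ℝ} (hK : 0 < K)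
    (hη : 0 < η) :
    ∃ C, 0 ≤ C ∧ ∀ s : ℂ, s.re ≤ c → (∀ k : ℕ, k ≤ d → η ≤ ‖s - k‖) →
      (⨅ j, Φ.ratio j) ^ s.re ≤ K * ‖moran Φ.ratio s‖ →
      ‖Φ.tubularZetaAction G κ φ s‖ ≤
        C * (inradius G / ((⨅ j, Φ.ratio j) * b)) ^ s.re * (1 + s.im ^ 2)⁻¹ := by
  set ρ := ⨅ j, Φ.ratio j
  have hρ : 0 < ρ := Φ.ratio_iInf_pos
  have hb : 0 < b := ha.trans_le hab
  set g := inradius G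
  obtain ⟨C, hC⟩ := exists_mellin_test_decay hφ ha hab hs (d + 1 - c)
  set P := ∑ k ∈ Finset.range (d + 1), g ^ (-(k : ℝ)) / η * |κ k|
  have hP : 0 ≤ P := Finset.sum_nonneg fun k _ => by positivity
  refine ⟨K * P * |C| * b ^ (d + 1 : ℝ), by positivity, fun s hsc hsk hsm => ?_⟩
  have hm := hC (d + 1 - s) (by simp; linarith)
  have hre : ((d : ℂ) + 1 - s).re = d + 1 - s.re := by simp
  have him : ((d : ℂ) + 1 - s).im = -s.im := by simp
  rw [hre, him, neg_sq] at hm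
  have hρx : 0 < ρ ^ s.re := Real.rpow_pos_of_pos hρ _
  have hmor : 0 < ‖moran Φ.ratio s‖ := by
    by_contra! h
    exact absurd (hsm.trans (mul_nonpos_of_nonneg_of_nonpos hK.le h)) (not_le.2 hρx)
  have h1 : ‖(moran Φ.ratio s)⁻¹‖ ≤ K / ρ ^ s.re := by
    rw [norm_inv, inv_le_comm₀ hmor (by positivity), inv_div, div_le_iff₀' hK]
    exact hsm
  have h2 := norm_polarSum_le (κ := κ) hg hη hsk
  have h3 : ‖mellin φ (d + 1 - s)‖ ≤ |C| * (b ^ (d + 1 : ℝ) / b ^ s.re) * (1 + s.im ^ 2)⁻¹ := by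
    rw [← Real.rpow_sub hb, ← div_eq_mul_inv, le_div_iff₀ (by positivity), mul_comm]
    exact hm.trans (mul_le_mul_of_nonneg_right (le_abs_self C) (by positivity))
  rw [tubularZetaAction_eq, norm_mul, norm_mul]
  calc _ ≤ K / ρ ^ s.re * (P * g ^ s.re) *
        (|C| * (b ^ (d + 1 : ℝ) / b ^ s.re) * (1 + s.im ^ 2)⁻¹) := by gcongr
    _ = _ := by
      rw [Real.div_rpow hg.le (by positivity), Real.mul_rpow hρ.le hb.le]
      field_simp

theorem integrable_tubularZetaAction_line (hg : 0 < inradius G) (hφ : ContDiff ℝ (⊤ : ℕ∞) φ)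
    (ha : 0 < a) (hab : a ≤ b) (hs : tsupport φ ⊆ Icc a b) {c : ℝ}
    (hc : ∑ j, Φ.ratio j ^ c < 1) (hck : ∀ k : ℕ, k ≤ d → c ≠ k) :
    Integrable fun y : ℝ => Φ.tubularZetaAction G κ φ (c + y * Complex.I) := by
  have hre : ∀ y : ℝ, ((c : ℂ) + y * Complex.I).re = c := fun y => by simp
  have him : ∀ y : ℝ, ((c : ℂ) + y * Complex.I).im = y := fun y => by simp
  obtain ⟨k₀, hk₀, hmin⟩ := (Finset.range (d + 1)).exists_min_image (fun k : ℕ => |c - k|)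
    ⟨0, by simp⟩
  have hη : 0 < |c - k₀| :=
    abs_pos.2 (sub_ne_zero.2 (hck k₀ (Finset.mem_range_succ_iff.1 hk₀)))
  have hsub : 0 < 1 - ∑ j, Φ.ratio j ^ c := sub_pos.2 hc
  have hρ := Φ.ratio_iInf_pos
  -- On the line `Re s = c` the triangle inequality gives `|moran s| ≥ 1 - ∑ r_j ^ c`, whence this
  -- value of `K`.
  obtain ⟨C, hC0, hC⟩ := exists_tubularZetaAction_bound (Φ := Φ) (κ := κ) hg hφ ha hab hs c
    (K := (⨅ j, Φ.ratio j) ^ c / (1 - ∑ j, Φ.ratio j ^ c)) (by positivity) hη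
  have hcont : Continuous fun y : ℝ => Φ.tubularZetaAction G κ φ (c + y * Complex.I) := by
    refine continuous_iff_continuousAt.2 fun y => ?_
    refine ContinuousAt.comp (f := fun y : ℝ => (c : ℂ) + y * Complex.I)
      (differentiableAt_tubularZetaAction hg hφ.continuous ha hs
        (moran_ne_zero Φ.ratio_pos (by rwa [hre])) fun k hk h => hck k hk ?_).continuousAt
      (by fun_prop)
    have := congrArg Complex.re h
    simpa using this
  refine (integrable_inv_one_add_sq.const_mul
    (C * (inradius G / ((⨅ j, Φ.ratio j) * b)) ^ c)).mono' hcont.aestronglyMeasurable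
    (ae_of_all _ fun y => ?_)
  have h := hC (c + y * Complex.I) (hre y).le (fun k hk => ?_) ?_
  · rwa [hre, him] at h
  · refine (hmin k (Finset.mem_range_succ_iff.2 hk)).trans ?_
    have := Complex.abs_re_le_norm ((c : ℂ) + y * Complex.I - k)
    simpa using this
  · have := one_sub_sum_le_norm_moran Φ.ratio_pos ((c : ℂ) + y * Complex.I)
    rw [hre] at this ⊢
    rw [div_mul_eq_mul_div, le_div_iff₀ hsub]
    gcongr

/-- The strict inequality `∑ r_j ^ d < 1` persists slightly to the left of `d` by continuity. -/
theorem exists_abscissa (hΦ : Φ.TilesetCondition) (hG : G ∈ Φ.generators)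
    (hg : 0 < inradius G) : ∃ c : ℝ, (d : ℝ) - 1 < c ∧ c < d ∧ ∑ j, Φ.ratio j ^ c < 1 := by
  have hcont : Continuous fun x : ℝ => ∑ j, Φ.ratio j ^ x :=
    continuous_finsetSum _ fun j _ => Real.continuous_const_rpow (Φ.ratio_pos j).ne'
  have h1 : ∑ j, Φ.ratio j ^ (d : ℝ) < 1 := by
    simpa only [Real.rpow_natCast] using sum_ratio_pow_lt_one hΦ hG hg
  have h2 : ∀ᶠ x in 𝓝[<] (d : ℝ), ∑ j, Φ.ratio j ^ x < 1 :=
    (hcont.continuousAt.eventually_lt_const h1).filter_mono nhdsWithin_le_nhds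
  obtain ⟨c, hc, hc'⟩ := (h2.and (Ioo_mem_nhdsLT (sub_one_lt (d : ℝ)))).exists
  exact ⟨c, hc'.1, hc'.2, hc⟩

/-- The contour shift. With `Q = g / (ρ b) > 1`, the left edge at `-n` has integrand `O(Q^{-n})` and
length `O(n)`; the horizontal edges have integrand `O(n^{-2})` and length `O(n)`; the right edge
tends to the full line integral. -/
theorem tendsto_sum_residueAt (hΦ : Φ.TilesetCondition) (hG : Φ.generators = {G})
    (hg : 0 < inradius G) (hκ : IsMonophase G κ) {c : ℝ} (hc1 : (d : ℝ) - 1 < c) (hc2 : c < d)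
    (hc : ∑ j, Φ.ratio j ^ c < 1) {T : ℕ → ℝ} (hTatTop : Tendsto T atTop atTop)
    (hT : ∀ n : ℕ, (n : ℝ) + 1 ≤ T n ∧ T n ≤ 2 * n + 3) {K A : ℝ} (hK : 0 < K)
    (hbound : ∀ s : ℂ, s.re ≤ c → (s.re ≤ A ∨ ∃ n, |s.im| = T n) →
        (⨅ i, Φ.ratio i) ^ s.re ≤ K * ‖moran Φ.ratio s‖)
    (hφ : ContDiff ℝ (⊤ : ℕ∞) φ) (ha : 0 < a) (hab : a ≤ b) (hs : tsupport φ ⊆ Icc a b)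
    (hb : b < inradius G / ⨅ j, Φ.ratio j) :
    Tendsto (fun n => ∑ᶠ ω ∈ Φ.complexDimensions ∩ {ω | |ω.im| ≤ T n},
        residueAt (Φ.tubularZetaAction G κ φ) ω) atTop
      (𝓝 (∫ ε in Ioi (0 : ℝ), (innerTubeVolume Φ.tilingSet ε : ℂ) * φ ε)) := by
  set F := Φ.tubularZetaAction G κ φ with hF
  set ρ := ⨅ j, Φ.ratio j
  have hρ : 0 < ρ := Φ.ratio_iInf_pos
  have hb0 : 0 < b := ha.trans_le hab
  set Q := inradius G / (ρ * b) with hQ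
  have hQ1 : 1 < Q := by
    rw [hQ, one_lt_div (by positivity), mul_comm]
    exact (lt_div_iff₀ hρ).1 hb
  have hQ0 : 0 < Q := zero_lt_one.trans hQ1
  obtain ⟨C, hC0, hC⟩ := exists_tubularZetaAction_bound (Φ := Φ) (κ := κ) hg hφ ha hab hs c hK
    one_pos
  have hT1 : ∀ n, 1 ≤ T n := fun n => by
    have : (0 : ℝ) ≤ n := n.cast_nonneg
    linarith [(hT n).1]
  have hmor : ∀ s : ℂ, moran Φ.ratio s = 0 → s.re < c := fun s h => by
    by_contra! hle
    exact moran_ne_zero Φ.ratio_pos (sum_rpow_lt_one_of_le Φ.ratio_pos Φ.ratio_lt_one hle hc) h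
  -- The lower bound also keeps the scaling dimensions off the horizontal edges and, once `-n ≤ A`,
  -- off the left edge.
  have hmor' : ∀ s : ℂ, moran Φ.ratio s = 0 → ¬ (s.re ≤ A ∨ ∃ n, |s.im| = T n) := fun s h h' => by
    have := hbound s (hmor s h).le h'
    rw [h, norm_zero, mul_zero] at this
    exact absurd this (not_le.2 (Real.rpow_pos_of_pos hρ _))
  have hre : ∀ x y : ℝ, ((x : ℂ) + y * Complex.I).re = x := fun x y => by simp
  have him : ∀ x y : ℝ, ((x : ℂ) + y * Complex.I).im = y := fun x y => by simp
  have hdim : ∀ ω, ω ∈ Φ.complexDimensions ↔ moran Φ.ratio ω = 0 ∨ ∃ k < d, ω = (k : ℂ) :=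
    fun ω => by rw [complexDimensions, scalingDimensions_eq]; rfl
  have hk : ∀ k : ℕ, k < d → (k : ℝ) < c := fun k hk => by
    have : (k : ℝ) + 1 ≤ d := by exact_mod_cast hk
    linarith
  -- the residue theorem on `[-n, c] × [-T n, T n]`
  have hres : ∀ᶠ n : ℕ in atTop, ∑ᶠ ω ∈ Φ.complexDimensions ∩ {ω | |ω.im| ≤ T n}, residueAt F ω =
      (2 * Real.pi * Complex.I)⁻¹ * rectIntegral F (-(n : ℝ)) c (-T n) (T n) := by
    filter_upwards [eventually_ge_atTop 1, tendsto_natCast_atTop_atTop.eventually_ge_atTop (-A),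
      tendsto_natCast_atTop_atTop.eventually_ge_atTop (-c)] with n hn1 hnA hnc
    have hfin := Φ.finite_complexDimensions_inter (T n)
    have hn1' : (1 : ℝ) ≤ n := by exact_mod_cast hn1
    rw [finsum_mem_eq_finite_toFinset_sum _ hfin, rectIntegral_eq_sum_residueAt (by linarith)
      (by linarith [hT1 n]) hfin.toFinset, inv_mul_cancel_left₀ Complex.two_pi_I_ne_zero]
    · intro ω hω
      obtain ⟨h1, h2⟩ := hfin.mem_toFinset.1 hω
      have h2' : |ω.im| ≤ T n := h2
      rcases (hdim ω).1 h1 with h | ⟨k, hkd, rfl⟩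
      · have h3 := hmor' ω h
        push Not at h3
        exact ⟨⟨by linarith [h3.1], hmor ω h⟩, abs_lt.1 (lt_of_le_of_ne h2' (h3.2 n))⟩
      · have : (0 : ℝ) ≤ k := k.cast_nonneg
        simp only [Complex.natCast_re, Complex.natCast_im, mem_Ioo]
        exact ⟨⟨by linarith, hk k hkd⟩, by linarith [hT1 n], by linarith [hT1 n]⟩
    · exact fun ω _ => meromorphicAt_tubularZetaAction hg hφ.continuous ha hs ω
    · intro z hz1 hz2 hz3
      rw [hfin.mem_toFinset] at hz3
      have hz4 : z ∉ Φ.complexDimensions := fun h => hz3 ⟨h, abs_le.2 hz2⟩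
      rw [hdim] at hz4
      push Not at hz4
      refine differentiableAt_tubularZetaAction hg hφ.continuous ha hs hz4.1 fun k hkd => ?_
      -- The pole of the polar sum at `d` is not a listed dimension; it is excluded because `Re z ≤
      -- c < d`.
      rcases hkd.eq_or_lt with rfl | hkd
      · rintro rfl
        have := hz1.2
        rw [Complex.natCast_re] at this
        linarith
      · exact hz4.2 k hkd
  -- the horizontal edges
  have hhor : ∀ (y : ℕ → ℝ), (∀ n, |y n| = T n) →
      Tendsto (fun n : ℕ => ∫ x : ℝ in -(n : ℝ)..c, F (x + y n * Complex.I)) atTop (𝓝 0) := by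
    intro y hy
    have ht : Tendsto (fun n : ℕ => C * Q ^ c * (|c| + 1) * (1 / ((n : ℝ) + 1))) atTop
        (𝓝 (C * Q ^ c * (|c| + 1) * 0)) := tendsto_one_div_add_atTop_nhds_zero_nat.const_mul _
    rw [mul_zero] at ht
    refine squeeze_zero_norm' ?_ ht
    filter_upwards [tendsto_natCast_atTop_atTop.eventually_ge_atTop (-c)] with n hnc
    have hn0 : (0 : ℝ) ≤ n := n.cast_nonneg
    have hb : ∀ x ∈ uIoc (-(n : ℝ)) c, ‖F (x + y n * Complex.I)‖ ≤
        C * Q ^ c * (((n : ℝ) + 1) ^ 2)⁻¹ := by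
      intro x hx
      rw [uIoc_of_le (by linarith)] at hx
      have h := hC (x + y n * Complex.I) (by rw [hre]; exact hx.2) (fun k _ => ?_)
        (hbound _ (by rw [hre]; exact hx.2) (Or.inr ⟨n, by rw [him]; exact hy n⟩))
      · rw [hre, him] at h
        refine h.trans ?_
        have h1 : Q ^ x ≤ Q ^ c := Real.rpow_le_rpow_of_exponent_le hQ1.le hx.2
        have h2 : ((n : ℝ) + 1) ^ 2 ≤ 1 + y n ^ 2 := by
          rw [← sq_abs (y n), hy n]
          have := pow_le_pow_left₀ (by positivity) (hT n).1 2
          linarith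
        gcongr
      · have := Complex.abs_im_le_norm ((x : ℂ) + y n * Complex.I - k)
        rw [Complex.sub_im, him, Complex.natCast_im, sub_zero, hy n] at this
        exact (hT1 n).trans this
    refine (intervalIntegral.norm_integral_le_of_norm_le_const hb).trans ?_
    have h3 : |c - -(n : ℝ)| ≤ (|c| + 1) * (n + 1) := by
      rw [sub_neg_eq_add]
      refine (abs_add_le _ _).trans ?_
      rw [abs_of_nonneg hn0]
      nlinarith [abs_nonneg c]
    calc C * Q ^ c * (((n : ℝ) + 1) ^ 2)⁻¹ * |c - -(n : ℝ)|
        ≤ C * Q ^ c * (((n : ℝ) + 1) ^ 2)⁻¹ * ((|c| + 1) * (n + 1)) := by gcongr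
      _ = _ := by field_simp
  -- the left edge
  have hleft : Tendsto (fun n : ℕ => ∫ y : ℝ in -T n..T n, F ((-(n : ℝ) : ℝ) + y * Complex.I))
      atTop (𝓝 0) := by
    have hq0 : 0 ≤ Q⁻¹ := by positivity
    have hq1 : Q⁻¹ < 1 := inv_lt_one_of_one_lt₀ hQ1
    have ht : Tendsto (fun n : ℕ => C * (4 * ((n : ℝ) * Q⁻¹ ^ n) + 6 * Q⁻¹ ^ n)) atTop
        (𝓝 (C * (4 * 0 + 6 * 0))) :=
      (((tendsto_self_mul_const_pow_of_lt_one hq0 hq1).const_mul 4).add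
        ((tendsto_pow_atTop_nhds_zero_of_lt_one hq0 hq1).const_mul 6)).const_mul C
    rw [mul_zero, mul_zero, add_zero, mul_zero] at ht
    refine squeeze_zero_norm' ?_ ht
    filter_upwards [eventually_ge_atTop 1, tendsto_natCast_atTop_atTop.eventually_ge_atTop (-A),
      tendsto_natCast_atTop_atTop.eventually_ge_atTop (-c)] with n hn1 hnA hnc
    have hn1' : (1 : ℝ) ≤ n := by exact_mod_cast hn1
    have hb : ∀ y ∈ uIoc (-T n) (T n), ‖F ((-(n : ℝ) : ℝ) + y * Complex.I)‖ ≤ C * Q⁻¹ ^ n := by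
      intro y _
      have h := hC ((-(n : ℝ) : ℝ) + y * Complex.I) (by rw [hre]; linarith) (fun k _ => ?_)
        (hbound _ (by rw [hre]; linarith) (Or.inl (by rw [hre]; linarith)))
      · rw [hre, him, Real.rpow_neg hQ0.le, Real.rpow_natCast, ← inv_pow] at h
        refine h.trans (mul_le_of_le_one_right (by positivity) (inv_le_one_of_one_le₀ ?_))
        linarith [sq_nonneg y]
      · have := Complex.abs_re_le_norm (((-(n : ℝ) : ℝ) : ℂ) + y * Complex.I - k)
        rw [Complex.sub_re, hre, Complex.natCast_re] at this
        refine le_trans ?_ this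
        have hk0 : (0 : ℝ) ≤ k := k.cast_nonneg
        rw [abs_of_nonpos (by linarith)]
        linarith
    refine (intervalIntegral.norm_integral_le_of_norm_le_const hb).trans ?_
    have h3 : |T n - -T n| ≤ 4 * n + 6 := by
      rw [abs_of_nonneg (by linarith [hT1 n])]
      linarith [(hT n).2]
    calc C * Q⁻¹ ^ n * |T n - -T n| ≤ C * Q⁻¹ ^ n * (4 * n + 6) := by gcongr
      _ = _ := by ring
  -- the right edge
  have hright : Tendsto (fun n : ℕ => ∫ y : ℝ in -T n..T n, F (c + y * Complex.I)) atTop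
      (𝓝 (∫ y : ℝ, F (c + y * Complex.I))) := by
    refine intervalIntegral_tendsto_integral (integrable_tubularZetaAction_line hg hφ ha hab hs hc
      fun k hkd h => ?_) (tendsto_neg_atTop_atBot.comp hTatTop) hTatTop
    rcases hkd.eq_or_lt with rfl | hkd
    · linarith
    · linarith [hk k hkd]
  rw [integral_innerTubeVolume_mul_test hΦ hG hg hκ hc1 hc2 hc hφ ha hab hs]
  have hbot := hhor (fun n => -T n) fun n => by
    rw [abs_neg, abs_of_pos (zero_lt_one.trans_le (hT1 n))]
  have htop := hhor T fun n => abs_of_pos (zero_lt_one.trans_le (hT1 n))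
  have hlim := ((((hbot.sub htop).add (hright.const_mul Complex.I)).sub
    (hleft.const_mul Complex.I)).const_mul (2 * Real.pi * Complex.I : ℂ)⁻¹)
  refine (hlim.congr' ?_).trans (le_of_eq ?_)
  · filter_upwards [hres] with n hn
    rw [hn, rectIntegral]
  · congr 1
    have hpi : (Real.pi : ℂ) ≠ 0 := by exact_mod_cast Real.pi_ne_zero
    have hI := Complex.I_ne_zero
    rw [Complex.real_smul]
    push_cast
    field_simp
    ring

end SelfSimilarSystem

/-! ### Assembly of the tube formula -/

theorem exists_Icc_of_tsupport_subset_Ioo {φ : ℝ → ℂ} (hφ : HasCompactSupport φ) {R : ℝ}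
    (hR : 0 < R) (hs : tsupport φ ⊆ Ioo 0 R) :
    ∃ a b, 0 < a ∧ a ≤ b ∧ b < R ∧ tsupport φ ⊆ Icc a b := by
  rcases (tsupport φ).eq_empty_or_nonempty with he | hne
  · exact ⟨R / 2, R / 2, half_pos hR, le_rfl, half_lt_self hR, by simp [he]⟩
  · obtain ⟨a, ha⟩ := IsCompact.exists_isLeast hφ hne
    obtain ⟨b, hb⟩ := IsCompact.exists_isGreatest hφ hne
    exact ⟨a, b, (hs ha.1).1, ha.2 hb.1, (hs hb.1).2, fun x hx => ⟨ha.2 hx, hb.2 hx⟩⟩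

/-- Tube formula for self-similar tilings. The distribution `V(T, ·)` is the sum over the complex
dimensions `ω` of the distributions `res(ζ_T; ω)` (whose value at `φ` is the residue at `ω` of
`s ↦ ⟨ζ_T(·, s), φ⟩`), the sum being the limit of the finite partial sums over `|Im ω| ≤ T n`, for
a sequence `T n → ∞` that does not depend on the test function. -/
theorem theorem8p2 {d J : ℕ} (Φ : SelfSimilarSystem d J) (hΦ : Φ.TilesetCondition)
    (G : Set (EuclideanSpace ℝ (Fin d))) (hG : Φ.generators = {G})
    (κ : ℕ → ℝ) (hκ : IsMonophase G κ) :
    (∀ t : ℝ, (Φ.complexDimensions ∩ {ω | |ω.im| ≤ t}).Finite) ∧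
    ∃ T : ℕ → ℝ, StrictMono T ∧ Tendsto T atTop atTop ∧
      ∀ φ : ℝ → ℂ, ContDiff ℝ (⊤ : ℕ∞) φ → HasCompactSupport φ →
        tsupport φ ⊆ Ioo 0 (inradius G / ⨅ j, Φ.ratio j) →
        Tendsto
          (fun n => ∑ᶠ ω ∈ Φ.complexDimensions ∩ {ω | |ω.im| ≤ T n},
            residueAt (Φ.tubularZetaAction G κ φ) ω)
          atTop
          (𝓝 (∫ ε in Ioi (0 : ℝ), (innerTubeVolume Φ.tilingSet ε : ℂ) * φ ε)) := by
  refine ⟨Φ.finite_complexDimensions_inter, ?_⟩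
  have hmem : G ∈ Φ.generators := hG ▸ rfl
  have hρ := Φ.ratio_iInf_pos
  rcases le_or_gt (inradius G) 0 with hg | hg
  · -- a generator without interior: there are no nonzero test functions
    refine ⟨fun n => n, Nat.strictMono_cast, tendsto_natCast_atTop_atTop, fun φ _ _ hs => ?_⟩
    rw [Ioo_eq_empty (not_lt.2 (div_nonpos_of_nonpos_of_nonneg hg hρ.le)), subset_empty_iff,
      tsupport_eq_empty_iff] at hs
    have hz : Φ.tubularZetaAction G κ φ = fun _ => 0 := by
      funext s
      simp [SelfSimilarSystem.tubularZetaAction, hs]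
    have hr : ∀ ω, residueAt (fun _ => 0) ω = 0 := fun ω =>
      residueAt_eq_of_eventually (Eventually.of_forall fun R => by simp [circleIntegral])
    rw [hz]
    simp [hr, hs]
  · obtain ⟨c, hc1, hc2, hc⟩ := SelfSimilarSystem.exists_abscissa hΦ hmem hg
    have := Φ.nonempty_fin
    obtain ⟨T, hTm, hTt, hT, K, hK, A, hbound⟩ :=
      exists_moran_contours Φ.ratio_pos Φ.ratio_lt_one c
    refine ⟨T, hTm, hTt, fun φ hφ hφc hs => ?_⟩
    obtain ⟨a, b, ha, hab, hb, hs'⟩ := exists_Icc_of_tsupport_subset_Ioo hφc (div_pos hg hρ) hs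
    exact SelfSimilarSystem.tendsto_sum_residueAt hΦ hG hg hκ hc1 hc2 hc hTt hT hK hbound hφ ha
      hab hs' hb
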